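/- Conventions. A composition $\alpha=(\alpha_1,\dots,\alpha_n)$ is a finite sequence of positive integers; $l(\alpha)=n$ and $|\alpha|=\alpha_1+\cdots+\alpha_n$. The fat staircase $\Delta_\alpha$ is the diagram with $|\alpha|$ right-justified rows which, from top to bottom, consist of $\alpha_1$ rows of length $1$, then $\alpha_2$ rows of length $2$, ..., then $\alpha_n$ rows of length $n$ (the rotation by $180^\circ$ of the Ferrers diagram of $(n^{\alpha_n},\dots,2^{\alpha_2},1^{\alpha_1})$). For a partition $\mu$ and an integer $k\ge 0$ with $\mu_1-k\le l(\alpha)$, let $\mathcal S(\mu,\alpha^{\triangleleft};k)$ be the skew diagram obtained by placing the Ferrers diagram of $\mu$ immediately below $\Delta_\alpha$ so that the first row of $\mu$ begins one box below and $k$ boxes to the left of the bottom-left box of $\Delta_\alpha$. For a skew diagram $D$, $s_D=\sum_T x_1^{\#1\text{'s in }T}x_2^{\#2\text{'s in }T}\cdots$ is its skew Schur function, the sum being over all semistandard Young tableaux $T$ of shape $D$. A homogeneous symmetric function $f$ of degree $N$ is Schur-positive if $f=\sum_{\nu\vdash N}a_\nu s_\nu$ with all $a_\nu\ge 0$. The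 partition $\lambda^t$ is the transpose of $\lambda$. Theorem. Let $\alpha$ be a composition, let $\lambda=(\lambda_1)$ be a partition with exactly one part, and let $k$ be an integer with $0\le k\le 1$ and $\lambda_1-k\le l(\alpha)$. Then $$s_{\mathcal S(\lambda^t,\alpha^{\triangleleft};k)}-s_{\mathcal S(\lambda,\alpha^{\triangleleft};k)}$$ is Schur-positive. -/

import Mathlib

/-- A semistandard filling of a finite set `D` of boxes. The box `(i, j)` lies in row `i` (rows are
numbered from the top) and column `j` (columns are numbered from the left), both starting at `0`.
Rows increase weakly from left to right and columns increase strictly from top to bottom.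
As in Mathlib's `SemistandardYoungTableau`, the alphabet is `0 < 1 < 2 < ⋯` instead of
`1 < 2 < 3 < ⋯`. -/
structure SkewSSYT (D : Finset (ℕ × ℕ)) where
  entry : D → ℕ
  row_weak : ∀ p q : D, p.1.1 = q.1.1 → p.1.2 < q.1.2 → entry p ≤ entry q
  col_strict : ∀ p q : D, p.1.2 = q.1.2 → p.1.1 < q.1.1 → entry p < entry q

/-- The content of a tableau: how many times each letter occurs. -/
noncomputable def SkewSSYT.content {D : Finset (ℕ × ℕ)} (T : SkewSSYT D) : ℕ →₀ ℕ :=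
  ∑ p : D, Finsupp.single (T.entry p) 1

/-- There are only finitely many tableaux of given shape and content, so the coefficients of
`skewSchur` below are genuine counts. -/
theorem SkewSSYT.finite_content (D : Finset (ℕ × ℕ)) (m : ℕ →₀ ℕ) :
    Finite {T : SkewSSYT D // T.content = m} := by
  have key : ∀ (T : {T : SkewSSYT D // T.content = m}) (p : D), T.1.entry p ∈ m.support := by
    rintro ⟨T, rfl⟩ p
    have hc : T.content = ∑ q : D, Finsupp.single (T.entry q) 1 := rfl
    rw [Finsupp.mem_support_iff]
    change T.content (T.entry p) ≠ 0
    rw [hc, Finsupp.finsetSum_apply]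
    have h := Finset.single_le_sum
      (f := fun q : D => (Finsupp.single (T.entry q) 1 : ℕ →₀ ℕ) (T.entry p))
      (fun q _ => Nat.zero_le _) (Finset.mem_univ p)
    simp only [Finsupp.single_eq_same] at h
    omega
  refine Finite.of_injective
    (fun T (p : D) => (⟨T.1.entry p, key T p⟩ : m.support)) ?_
  rintro ⟨⟨e, _, _⟩, _⟩ ⟨⟨e', _, _⟩, _⟩ h
  have : e = e' := funext fun p => congrArg Subtype.val (congrFun h p)
  subst this
  rfl

/-- The skew Schur function `s_D = ∑_T x^T` in infinitely many variables: the coefficient of the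
monomial `x^m` is the number of semistandard tableaux of shape `D` with content `m`.
For a partition `ν`, the Schur function `s_ν` is `skewSchur ν.cells`. -/
noncomputable def skewSchur (D : Finset (ℕ × ℕ)) : MvPowerSeries ℕ ℤ :=
  fun m => (Nat.card {T : SkewSSYT D // T.content = m} : ℤ)

/-- `f` is a Schur-positive element of degree `n`: a linear combination, with nonnegative
coefficients, of the Schur functions `s_ν` with `ν ⊢ n`. -/
def SchurPositive (n : ℕ) (f : MvPowerSeries ℕ ℤ) : Prop :=
  ∃ a : YoungDiagram →₀ ℤ, (∀ ν ∈ a.support, ν.card = n) ∧ (∀ ν, 0 ≤ a ν) ∧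
    f = a.sum fun ν c => c • skewSchur ν.cells

/-- The row lengths `1, …, 1, 2, …, 2, …, n, …, n` (with `i` repeated `α_i` times), from top to
bottom, of the fat staircase `Δ_α` of a composition `α = (α_1, …, α_n)`. -/
def fatStaircaseRows {m : ℕ} (α : Composition m) : List ℕ :=
  (α.blocks.zipIdx 1).flatMap fun p => List.replicate p.1 p.2

/-- The fat staircase `Δ_α`, the rotation by 180° of the diagram of the partition
`(n^{α_n}, …, 2^{α_2}, 1^{α_1})`: its rows have the lengths `fatStaircaseRows α` and are
right-justified in the columns `0, …, n - 1`. The rows are `0, …, |α| - 1`. -/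
def fatStaircase {m : ℕ} (α : Composition m) : Finset (ℕ × ℕ) :=
  (Finset.range (fatStaircaseRows α).length ×ˢ Finset.range α.length).filter
    fun p => α.length ≤ p.2 + (fatStaircaseRows α).getD p.1 0

/-- The fat staircase with bad foundation `S(μ, α^◁; k)`: the diagram of the partition `μ` is placed
immediately below `Δ_α` (which has `|α| = m` rows), its first row starting `k` boxes to the left of
the bottom-left box of `Δ_α`. Here `Δ_α` is moved `k` columns to the right, so that its bottom-left
box is in column `k`, and `μ` starts in column `0` of row `m`. -/
def badFoundation {m : ℕ} (μ : YoungDiagram) (α : Composition m) (k : ℕ) : Finset (ℕ × ℕ) :=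
  (fatStaircase α).image (fun p => (p.1, p.2 + k)) ∪ μ.cells.image (fun p => (m + p.1, p.2))

/-! Write n = l(α) and r = λ₁, number rows from 0, and let ν be the Young diagram obtained by
rotating Δ_α by 180°, so that ν_0 = n and ν_i ≤ ν_{i+1} + 1. Rotating the two skew diagrams puts a
row, respectively a column, of r boxes above ν. Both skew Schur functions are then multiplicity-free
sums of s_η over diagrams η for which η/ν is a vertical strip of r boxes, and the index set of the
row is contained in that of the column.

Row: the rotated diagram is ν with a row of n + k boxes on top, minus the first n + k - r boxes of
that row. Its skew Schur function is the sum of s_η over all η left after removing a horizontal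
strip of n + k - r boxes (`skewSchur_badFoundation_row`). Such an η satisfies ν_0 ≤ η_0 ≤ n + k and
ν_{i+1} ≤ η_{i+1} ≤ ν_i. The staircase property and k ≤ 1 leave at most one new box per row, and
none in row 0 if k = 0 (`mem_addVStrip_of_isStep`).

Column: for k = 1 the column is detached from ν, and the dual Pieri rule gives all vertical r-strips
(`skewSchur_columnAbove_rowLen`). For k = 0 it stands on the last column of ν, and exactly the
vertical r-strips that avoid row 0 occur (`skewSchur_columnAbove_last`).

The expansions rest on chains of strips. Tableaux of shape ν/τ are chains of horizontal strips from
ν down to τ (`ncard_tableauxOn_sdiff`). If τ is a single row or column, it is one further strip at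
the end of the chain. Strips commute (`ncard_hStrip_hStrip`, `ncard_hStrip_vStrip`), so this strip
can be removed first, and what remains are tableaux of straight shape (`skewSchur_sdiff_eq_sum`). -/

namespace YoungDiagram

/-! ### Young diagrams described by their row lengths -/

theorem le_iff_rowLen {μ ν : YoungDiagram} : μ ≤ ν ↔ ∀ i, μ.rowLen i ≤ ν.rowLen i := by
  constructor
  · intro h i
    by_contra! hlt
    have h1 : (i, ν.rowLen i) ∈ μ := mem_iff_lt_rowLen.2 hlt
    exact lt_irrefl _ (mem_iff_lt_rowLen.1 (h h1))
  · rintro h ⟨i, j⟩ hc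
    exact mem_iff_lt_rowLen.2 ((mem_iff_lt_rowLen.1 hc).trans_le (h i))

theorem ext_rowLen {μ ν : YoungDiagram} (h : ∀ i, μ.rowLen i = ν.rowLen i) : μ = ν :=
  le_antisymm (le_iff_rowLen.2 fun i => (h i).le) (le_iff_rowLen.2 fun i => (h i).ge)

theorem rowLen_eq_zero {μ : YoungDiagram} {i : ℕ} (h : μ.colLen 0 ≤ i) : μ.rowLen i = 0 := by
  by_contra h0
  have h1 : (i, 0) ∈ μ := mem_iff_lt_rowLen.2 (Nat.pos_of_ne_zero h0)
  exact absurd (mem_iff_lt_colLen.1 h1) (not_lt.2 h)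

theorem rowLen_succ_le (μ : YoungDiagram) (i : ℕ) : μ.rowLen (i + 1) ≤ μ.rowLen i :=
  μ.rowLen_anti _ _ i.le_succ

theorem card_eq_sum_rowLen (μ : YoungDiagram) {N : ℕ} (hN : μ.rowLen N = 0) :
    μ.card = ∑ i ∈ Finset.range N, μ.rowLen i := by
  have : μ.cells = ((Finset.range N).sigma fun i => Finset.range (μ.rowLen i)).map
      (Equiv.sigmaEquivProd ℕ ℕ).toEmbedding := by
    ext ⟨i, j⟩
    simp only [mem_cells, mem_iff_lt_rowLen, Finset.mem_map, Finset.mem_sigma, Finset.mem_range,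
      Equiv.coe_toEmbedding, Equiv.sigmaEquivProd_apply, Prod.mk.injEq, Sigma.exists]
    constructor
    · intro h
      refine ⟨i, j, ⟨?_, h⟩, rfl, rfl⟩
      by_contra! hle
      have := μ.rowLen_anti _ _ hle
      omega
    · rintro ⟨_, _, ⟨_, h⟩, rfl, rfl⟩
      exact h
  rw [YoungDiagram.card, this]
  simp

/-- The Young diagram with prescribed row lengths. -/
def ofFun (f : ℕ → ℕ) (hf : Antitone f) (N : ℕ) (_hN : f N = 0) : YoungDiagram where
  cells := (Finset.range N ×ˢ Finset.range (f 0)).filter fun p => p.2 < f p.1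
  isLowerSet := by
    rintro ⟨i, j⟩ ⟨i', j'⟩ ⟨hi, hj⟩ h
    simp only [Finset.coe_filter, Finset.mem_product, Finset.mem_range, Set.mem_ofPred_eq] at *
    have := hf hi
    omega

theorem rowLen_ofFun (f : ℕ → ℕ) (hf : Antitone f) (N : ℕ) (hN : f N = 0) (i : ℕ) :
    (ofFun f hf N hN).rowLen i = f i := by
  have key : ∀ j, j < (ofFun f hf N hN).rowLen i ↔ j < f i := by
    intro j
    rw [← mem_iff_lt_rowLen, ← mem_cells]
    simp only [ofFun, Finset.mem_filter, Finset.mem_product, Finset.mem_range]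
    constructor
    · exact fun h => h.2
    · intro h
      have h0 := hf (Nat.zero_le i)
      refine ⟨⟨?_, by omega⟩, h⟩
      by_contra! hle
      have := hf hle
      omega
  exact le_antisymm (le_of_forall_lt fun j hj => (key j).1 hj)
    (le_of_forall_lt fun j hj => (key j).2 hj)

theorem finite_le (ν : YoungDiagram) : {κ : YoungDiagram | κ ≤ ν}.Finite := by
  refine Set.Finite.of_finite_image (f := YoungDiagram.cells) ?_ ?_
  · exact (ν.cells.powerset.finite_toSet).subset (by rintro _ ⟨κ, h, rfl⟩; simpa using h)
  · intro a _ b _ h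
    exact YoungDiagram.ext h

/-- If the rows may be chosen independently from intervals `[lo i, hi i]` with at most two elements,
the number of diagrams of given size is a binomial coefficient. -/
theorem ncard_between (lo hi : ℕ → ℕ) (h1 : ∀ i, lo i ≤ hi i) (h2 : ∀ i, hi i ≤ lo i + 1)
    (h3 : ∀ i, hi (i + 1) ≤ lo i) (N : ℕ) (hN : hi N = 0) (x : ℕ) :
    {κ : YoungDiagram | (∀ i, lo i ≤ κ.rowLen i ∧ κ.rowLen i ≤ hi i) ∧ κ.card = x}.ncard =
      if ∑ i ∈ Finset.range N, lo i ≤ x then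
        (∑ i ∈ Finset.range N, hi i - ∑ i ∈ Finset.range N, lo i).choose
          (x - ∑ i ∈ Finset.range N, lo i)
      else 0 := by
  classical
  -- `F` consists of the rows with a genuine choice; a diagram is determined by the subset of `F` on
  -- which it takes the larger value.
  set F := (Finset.range N).filter fun i => lo i < hi i with hF
  have hsum : ∑ i ∈ Finset.range N, hi i = ∑ i ∈ Finset.range N, lo i + F.card := by
    rw [hF, Finset.card_filter, ← Finset.sum_add_distrib]
    refine Finset.sum_congr rfl fun i _ => ?_
    have := h1 i
    have := h2 i
    split_ifs <;> omega
  have hcard : ∀ κ : YoungDiagram, (∀ i, lo i ≤ κ.rowLen i ∧ κ.rowLen i ≤ hi i) →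
      κ.card = ∑ i ∈ Finset.range N, lo i + (F.filter fun i => lo i < κ.rowLen i).card := by
    intro κ hκ
    rw [κ.card_eq_sum_rowLen (N := N) (by have := hκ N; omega), hF, Finset.filter_filter,
      Finset.card_filter, ← Finset.sum_add_distrib]
    refine Finset.sum_congr rfl fun i _ => ?_
    have := hκ i
    have := h2 i
    split_ifs <;> omega
  split_ifs with hx
  · rw [hsum, Nat.add_sub_cancel_left, ← Finset.card_powersetCard, ← Set.ncard_coe_finset]
    refine Set.ncard_congr (fun κ _ => F.filter fun i => lo i < κ.rowLen i) ?_ ?_ ?_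
    · rintro κ ⟨hκ, hx⟩
      have := hcard κ hκ
      simp only [Finset.mem_coe, Finset.mem_powersetCard]
      exact ⟨Finset.filter_subset _ _, by omega⟩
    · rintro κ κ' ⟨hκ, -⟩ ⟨hκ', -⟩ h
      refine ext_rowLen fun i => ?_
      have a := hκ i
      have a' := hκ' i
      have b := h2 i
      have hi' := Finset.ext_iff.1 h i
      simp only [hF, Finset.mem_filter, Finset.mem_range] at hi'
      by_cases hiN : i < N
      · simp only [hiN, true_and] at hi'
        by_cases hl : lo i < hi i
        · simp only [hl, true_and] at hi'
          omega
        · omega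
      · have c := κ.rowLen_anti _ _ (not_lt.1 hiN)
        have c' := κ'.rowLen_anti _ _ (not_lt.1 hiN)
        have := hκ N
        have := hκ' N
        omega
    · intro S hS
      simp only [Finset.mem_coe, Finset.mem_powersetCard] at hS
      have hlh : ∀ i, lo i + (if i ∈ S then 1 else 0) ≤ hi i := by
        intro i
        have := h1 i
        split_ifs with hi
        · have := hS.1 hi
          simp only [hF, Finset.mem_filter] at this
          omega
        · omega
      have hanti : Antitone fun i => lo i + (if i ∈ S then 1 else 0) :=
        antitone_nat_of_succ_le fun i => (hlh (i + 1)).trans ((h3 i).trans (Nat.le_add_right _ _))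
      have hz : lo N + (if N ∈ S then 1 else 0) = 0 := by have := hlh N; omega
      set κ := ofFun _ hanti N hz with hκ
      have hr : ∀ i, κ.rowLen i = lo i + (if i ∈ S then 1 else 0) := rowLen_ofFun _ hanti N hz
      have hb : ∀ i, lo i ≤ κ.rowLen i ∧ κ.rowLen i ≤ hi i := fun i => by
        rw [hr]; exact ⟨Nat.le_add_right _ _, hlh i⟩
      have hfil : (F.filter fun i => lo i < κ.rowLen i) = S := by
        ext i
        simp only [Finset.mem_filter, hr]
        constructor
        · rintro ⟨_, h⟩
          by_contra hn
          simp [hn] at h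
        · exact fun h => ⟨hS.1 h, by simp [h]⟩
      refine ⟨κ, ⟨hb, ?_⟩, hfil⟩
      rw [hcard κ hb, hfil, hS.2]
      omega
  · rw [Set.ncard_eq_zero ((finite_le (ofFun hi (antitone_nat_of_succ_le fun i =>
      (h3 i).trans (h1 i)) N hN)).subset fun κ hκ => le_iff_rowLen.2 fun i => by
        rw [rowLen_ofFun]; exact (hκ.1 i).2), Set.eq_empty_iff_forall_notMem]
    rintro κ ⟨hκ, hx'⟩
    have := hcard κ hκ
    omega

/-! ### Horizontal and vertical strips commute -/

/-- `ν / κ` is a horizontal strip. -/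
def HStrip (ν κ : YoungDiagram) : Prop := ∀ i, κ.rowLen i ≤ ν.rowLen i ∧ ν.rowLen (i + 1) ≤ κ.rowLen i

/-- `ν / κ` is a vertical strip. -/
def VStrip (ν κ : YoungDiagram) : Prop := ∀ i, κ.rowLen i ≤ ν.rowLen i ∧ ν.rowLen i ≤ κ.rowLen i + 1

theorem HStrip.le {ν κ : YoungDiagram} (h : HStrip ν κ) : κ ≤ ν := le_iff_rowLen.2 fun i => (h i).1

theorem VStrip.le {ν κ : YoungDiagram} (h : VStrip ν κ) : κ ≤ ν := le_iff_rowLen.2 fun i => (h i).1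

/-- The summands are the least and greatest row lengths of a diagram interlacing between ν and τ.
Shifted by one row they pair up, since the maximum and minimum of τ_i and ν_{i+1} add up to τ_i +
ν_{i+1}. -/
theorem sum_lo_add_sum_hi {ν τ : YoungDiagram} (hτ : τ ≤ ν) {N : ℕ} (hN : ν.rowLen N = 0) :
    ∑ i ∈ Finset.range (N + 1), max (τ.rowLen i) (ν.rowLen (i + 1)) +
      ∑ i ∈ Finset.range (N + 1),
        (if i = 0 then ν.rowLen 0 else min (ν.rowLen i) (τ.rowLen (i - 1))) = ν.card + τ.card := by
  have hτ' := le_iff_rowLen.1 hτ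
  have hN1 : ν.rowLen (N + 1) = 0 := by have := ν.rowLen_succ_le N; omega
  have hτN : τ.rowLen N = 0 := by have := hτ' N; omega
  rw [ν.card_eq_sum_rowLen hN1, τ.card_eq_sum_rowLen hτN, Finset.sum_range_succ,
    Finset.sum_range_succ' (fun i => if i = 0 then _ else _), Finset.sum_range_succ' ν.rowLen]
  simp only [hN1, hτN, max_self, Nat.add_sub_cancel, if_true, Nat.add_eq_zero_iff, one_ne_zero,
    and_false, if_false, add_zero]
  have : ∑ i ∈ Finset.range N, max (τ.rowLen i) (ν.rowLen (i + 1)) +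
      ∑ i ∈ Finset.range N, min (ν.rowLen (i + 1)) (τ.rowLen i) =
      ∑ i ∈ Finset.range N, ν.rowLen (i + 1) + ∑ i ∈ Finset.range N, τ.rowLen i := by
    rw [← Finset.sum_add_distrib, ← Finset.sum_add_distrib]
    exact Finset.sum_congr rfl fun i _ => by omega
  omega

/-- The Bender–Knuth symmetry: two consecutive horizontal strips may be interchanged. -/
theorem ncard_hStrip_hStrip (ν σ : YoungDiagram) (a b : ℕ) :
    {κ | (HStrip ν κ ∧ ν.card = κ.card + a) ∧ HStrip κ σ ∧ κ.card = σ.card + b}.ncard =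
      {κ | (HStrip ν κ ∧ ν.card = κ.card + b) ∧ HStrip κ σ ∧ κ.card = σ.card + a}.ncard := by
  set lo : ℕ → ℕ := fun i => max (σ.rowLen i) (ν.rowLen (i + 1)) with hlo
  set hi : ℕ → ℕ :=
    fun i => if i = 0 then ν.rowLen 0 else min (ν.rowLen i) (σ.rowLen (i - 1)) with hhi
  have hbd : ∀ κ, HStrip ν κ ∧ HStrip κ σ ↔ ∀ i, lo i ≤ κ.rowLen i ∧ κ.rowLen i ≤ hi i := by
    intro κ
    constructor
    · rintro ⟨h, h'⟩ i
      rcases i with _ | i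
      · have := h 0
        have := h' 0
        simp only [hlo, hhi, if_true]
        omega
      · have := h (i + 1)
        have := h' (i + 1)
        have := h' i
        simp only [hlo, hhi, Nat.add_eq_zero_iff, one_ne_zero, and_false, if_false,
          Nat.add_sub_cancel]
        omega
    · intro h
      have h' : ∀ i, σ.rowLen i ≤ κ.rowLen i ∧ ν.rowLen (i + 1) ≤ κ.rowLen i ∧
          κ.rowLen i ≤ ν.rowLen i ∧ κ.rowLen (i + 1) ≤ σ.rowLen i := by
        intro i
        have a := h i
        have b := h (i + 1)
        simp only [hlo, hhi, Nat.add_eq_zero_iff, one_ne_zero, and_false, if_false,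
          Nat.add_sub_cancel] at a b
        split_ifs at a with h0
        · subst h0; omega
        · omega
      exact ⟨fun i => ⟨(h' i).2.2.1, (h' i).2.1⟩, fun i => ⟨(h' i).1, (h' i).2.2.2⟩⟩
  have hanti : ∀ i, hi (i + 1) ≤ lo i := by
    intro i
    simp only [hlo, hhi, Nat.add_eq_zero_iff, one_ne_zero, and_false, if_false,
      Nat.add_sub_cancel]
    omega
  set N := ν.colLen 0 with hN
  have hνN : ν.rowLen N = 0 := rowLen_eq_zero le_rfl
  have hN1 : hi (N + 1) = 0 := by
    have := ν.rowLen_succ_le N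
    simp only [hhi, Nat.add_eq_zero_iff, one_ne_zero, and_false, if_false]
    omega
  -- Reflecting each row in its interval [lo i, hi i] is an involution that exchanges the sizes of
  -- the two strips.
  have key : ∀ κ, HStrip ν κ ∧ HStrip κ σ → ∃ κ', (HStrip ν κ' ∧ HStrip κ' σ) ∧
      (∀ i, κ'.rowLen i = lo i + hi i - κ.rowLen i) ∧ κ'.card + κ.card = ν.card + σ.card := by
    intro κ hκ
    have hσ : σ ≤ ν := hκ.2.le.trans hκ.1.le
    rw [hbd] at hκ
    have hA : Antitone fun i => lo i + hi i - κ.rowLen i := by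
      refine antitone_nat_of_succ_le fun i => ?_
      have a := hκ i
      have b := hκ (i + 1)
      have c := hanti i
      omega
    have hz : lo (N + 1) + hi (N + 1) - κ.rowLen (N + 1) = 0 := by
      have := hκ (N + 1)
      omega
    refine ⟨ofFun _ hA (N + 1) hz, ?_, rowLen_ofFun _ hA _ hz, ?_⟩
    · rw [hbd]
      intro i
      have := hκ i
      rw [rowLen_ofFun]
      omega
    · rw [← sum_lo_add_sum_hi hσ hνN, card_eq_sum_rowLen _ (N := N + 1) (by rw [rowLen_ofFun, hz]),
        card_eq_sum_rowLen κ (N := N + 1) (by have := hκ (N + 1); omega),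
        ← Finset.sum_add_distrib, ← Finset.sum_add_distrib]
      refine Finset.sum_congr rfl fun i _ => ?_
      have := hκ i
      rw [rowLen_ofFun]
      simp only [hlo, hhi] at this ⊢
      omega
  choose! φ h1 h2 h3 using key
  refine Set.ncard_congr (fun κ _ => φ κ) ?_ ?_ ?_
  · rintro κ ⟨⟨h, ha⟩, h', hb⟩
    have A := h1 κ ⟨h, h'⟩
    have B := h3 κ ⟨h, h'⟩
    exact ⟨⟨A.1, by omega⟩, A.2, by omega⟩
  · rintro κ κ' ⟨⟨h, -⟩, h', -⟩ ⟨⟨g, -⟩, g', -⟩ he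
    refine ext_rowLen fun i => ?_
    have A := h2 κ ⟨h, h'⟩ i
    have B := h2 κ' ⟨g, g'⟩ i
    have a := (hbd κ).1 ⟨h, h'⟩ i
    have b := (hbd κ').1 ⟨g, g'⟩ i
    rw [he] at A
    omega
  · rintro κ ⟨⟨h, ha⟩, h', hb⟩
    have A := h1 κ ⟨h, h'⟩
    have B := h3 κ ⟨h, h'⟩
    refine ⟨φ κ, ⟨⟨A.1, by omega⟩, A.2, by omega⟩, ?_⟩
    refine ext_rowLen fun i => ?_
    rw [h2 _ A, h2 κ ⟨h, h'⟩]
    have a := (hbd κ).1 ⟨h, h'⟩ i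
    omega

/-- A horizontal and a vertical strip may be interchanged. -/
theorem ncard_hStrip_vStrip (ν σ : YoungDiagram) (a b : ℕ) :
    {κ | (HStrip ν κ ∧ ν.card = κ.card + a) ∧ VStrip κ σ ∧ κ.card = σ.card + b}.ncard =
      {κ | (VStrip ν κ ∧ ν.card = κ.card + b) ∧ HStrip κ σ ∧ κ.card = σ.card + a}.ncard := by
  -- Removals in either order force this condition, so otherwise both counts vanish. Conversely it
  -- makes all the intervals below nonempty.
  by_cases hex : (∀ i, σ.rowLen i ≤ ν.rowLen i ∧ ν.rowLen (i + 1) ≤ σ.rowLen i + 1) ∧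
      ν.card = σ.card + (a + b)
  swap
  · rw [show {κ | (HStrip ν κ ∧ ν.card = κ.card + a) ∧ VStrip κ σ ∧ κ.card = σ.card + b} = ∅ from ?_,
      show {κ | (VStrip ν κ ∧ ν.card = κ.card + b) ∧ HStrip κ σ ∧ κ.card = σ.card + a} = ∅ from ?_]
    · rw [Set.eq_empty_iff_forall_notMem]
      rintro κ ⟨⟨h, ha⟩, h', hb⟩
      refine hex ⟨fun i => ?_, by omega⟩
      have := h i
      have := h (i + 1)
      have := h' i
      omega
    · rw [Set.eq_empty_iff_forall_notMem]
      rintro κ ⟨⟨h, ha⟩, h', hb⟩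
      refine hex ⟨fun i => ?_, by omega⟩
      have := h i
      have := h' i
      omega
  obtain ⟨hex, hab⟩ := hex
  have hσ : σ ≤ ν := le_iff_rowLen.2 fun i => (hex i).1
  -- For fixed ν and σ each row of κ varies independently in an interval with at most two elements:
  -- [lo, hi] when the horizontal strip is removed first, [lo', hi'] when the vertical one is.
  set lo : ℕ → ℕ := fun i => max (σ.rowLen i) (ν.rowLen (i + 1)) with hlo
  set hi : ℕ → ℕ := fun i => min (ν.rowLen i) (σ.rowLen i + 1) with hhi
  set lo' : ℕ → ℕ := fun i => max (σ.rowLen i) (ν.rowLen i - 1) with hlo'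
  set hi' : ℕ → ℕ :=
    fun i => if i = 0 then ν.rowLen 0 else min (ν.rowLen i) (σ.rowLen (i - 1)) with hhi'
  have hi'_succ : ∀ i, hi' (i + 1) = min (ν.rowLen (i + 1)) (σ.rowLen i) := fun i => by
    simp [hhi']
  have hi'_zero : hi' 0 = ν.rowLen 0 := by simp [hhi']
  set N := ν.colLen 0 with hN
  have hνN : ν.rowLen N = 0 := rowLen_eq_zero le_rfl
  have hνN1 : ν.rowLen (N + 1) = 0 := by have := ν.rowLen_succ_le N; omega
  have E1 : {κ | (HStrip ν κ ∧ ν.card = κ.card + a) ∧ VStrip κ σ ∧ κ.card = σ.card + b} =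
      {κ | (∀ i, lo i ≤ κ.rowLen i ∧ κ.rowLen i ≤ hi i) ∧ κ.card = σ.card + b} := by
    ext κ
    constructor
    · rintro ⟨⟨h, ha⟩, h', hb⟩
      refine ⟨fun i => ?_, hb⟩
      have := h i
      have := h' i
      simp only [hlo, hhi]
      omega
    · rintro ⟨h, hb⟩
      refine ⟨⟨fun i => ?_, by omega⟩, fun i => ?_, hb⟩ <;>
      · have := h i
        simp only [hlo, hhi] at this
        omega
  have E2 : {κ | (VStrip ν κ ∧ ν.card = κ.card + b) ∧ HStrip κ σ ∧ κ.card = σ.card + a} =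
      {κ | (∀ i, lo' i ≤ κ.rowLen i ∧ κ.rowLen i ≤ hi' i) ∧ κ.card = σ.card + a} := by
    ext κ
    constructor
    · rintro ⟨⟨h, ha⟩, h', hb⟩
      refine ⟨fun i => ?_, hb⟩
      have a1 := h i
      have a2 := h' i
      rcases i with _ | i
      · rw [hi'_zero]
        simp only [hlo']
        omega
      · have a3 := h' i
        rw [hi'_succ]
        simp only [hlo']
        omega
    · rintro ⟨h, hb⟩
      refine ⟨⟨fun i => ?_, by omega⟩, fun i => ?_, hb⟩
      · have a1 := h i
        rcases i with _ | i
        · rw [hi'_zero] at a1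
          simp only [hlo'] at a1
          omega
        · rw [hi'_succ] at a1
          simp only [hlo'] at a1
          omega
      · have a1 := h i
        have a2 := h (i + 1)
        rw [hi'_succ] at a2
        simp only [hlo'] at a1 a2
        omega
  have S1 : ∑ i ∈ Finset.range (N + 1), lo i + ∑ i ∈ Finset.range (N + 1), hi' i =
      ν.card + σ.card := sum_lo_add_sum_hi hσ hνN
  have S2 : ∑ i ∈ Finset.range (N + 1), hi i + ∑ i ∈ Finset.range (N + 1), lo' i =
      ν.card + σ.card := by
    rw [card_eq_sum_rowLen ν hνN1, card_eq_sum_rowLen σ (N := N + 1)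
      (by have := (hex (N + 1)).1; omega), ← Finset.sum_add_distrib, ← Finset.sum_add_distrib]
    refine Finset.sum_congr rfl fun i _ => ?_
    have := hex i
    simp only [hhi, hlo']
    omega
  have hle : ∀ i, lo i ≤ hi i := fun i => by
    have := hex i
    have := ν.rowLen_succ_le i
    simp only [hhi, hlo]
    omega
  have hle' : ∀ i, lo' i ≤ hi' i := fun i => by
    rcases i with _ | i
    · have := hex 0
      rw [hi'_zero]
      simp only [hlo']
      omega
    · have := hex i
      have := hex (i + 1)
      have := σ.rowLen_succ_le i
      rw [hi'_succ]
      simp only [hlo']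
      omega
  have T1 := Finset.sum_le_sum fun i (_ : i ∈ Finset.range (N + 1)) => hle i
  have T2 := Finset.sum_le_sum fun i (_ : i ∈ Finset.range (N + 1)) => hle' i
  rw [E1, E2, ncard_between lo hi hle ?_ ?_ (N + 1) ?_, ncard_between lo' hi' hle' ?_ ?_ (N + 1) ?_]
  · set A := ∑ i ∈ Finset.range (N + 1), lo i
    set B := ∑ i ∈ Finset.range (N + 1), hi i
    set A' := ∑ i ∈ Finset.range (N + 1), lo' i
    set B' := ∑ i ∈ Finset.range (N + 1), hi' i
    -- `S1` and `S2` give A + B' = B + A', so both families have equally many free rows. As |ν| =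
    -- |σ| + a + b, the numbers of free rows taking the larger value add up to B - A, and the two
    -- binomial coefficients are complementary. If just one of the two sizes falls below its
    -- minimum, the lower index of the other coefficient is too large and it vanishes.
    have hF : B - A = B' - A' := by omega
    rw [hF]
    split_ifs with c1 c2 c2
    · rw [← Nat.choose_symm (by omega)]
      congr 1
      omega
    · exact Nat.choose_eq_zero_of_lt (by omega)
    · exact (Nat.choose_eq_zero_of_lt (by omega)).symm
    · rfl
  · intro i
    rcases i with _ | i
    · rw [hi'_zero]
      simp only [hlo']
      omega
    · rw [hi'_succ]
      simp only [hlo']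
      omega
  · intro i
    rw [hi'_succ]
    simp only [hlo']
    omega
  · rw [hi'_succ]
    omega
  · intro i
    simp only [hhi, hlo]
    omega
  · intro i
    simp only [hhi, hlo]
    omega
  · simp only [hhi]
    omega

end YoungDiagram
open YoungDiagram

/-! ### Chains of strips -/

/-- The strips that may be removed from a Young diagram. -/
inductive Strip
  | hor (c : ℕ)
  | ver (c : ℕ)

/-- Removing the strip `s` from `ν` may leave `κ`. -/
def Strip.IsStep : Strip → YoungDiagram → YoungDiagram → Prop
  | .hor c, ν, κ => HStrip ν κ ∧ ν.card = κ.card + c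
  | .ver c, ν, κ => VStrip ν κ ∧ ν.card = κ.card + c

theorem Strip.IsStep.le {s : Strip} {ν κ : YoungDiagram} (h : s.IsStep ν κ) : κ ≤ ν := by
  cases s with
  | hor c => exact h.1.le
  | ver c => exact h.1.le

theorem Strip.finite_isStep (s : Strip) (ν : YoungDiagram) : {κ | s.IsStep ν κ}.Finite :=
  ν.finite_le.subset fun _ h => h.le

/-- The diagrams that are left after removing the strip `s` from `ν`. -/
noncomputable def Strip.steps (s : Strip) (ν : YoungDiagram) : Finset YoungDiagram :=
  (s.finite_isStep ν).toFinset

@[simp] theorem Strip.mem_steps {s : Strip} {ν κ : YoungDiagram} :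
    κ ∈ s.steps ν ↔ s.IsStep ν κ := by
  simp [Strip.steps]

open Classical in
/-- The number of ways to get from `ν` to `τ` by removing a sequence of strips. -/
noncomputable def chainCount (τ : YoungDiagram) : List Strip → YoungDiagram → ℕ
  | [], ν => if ν = τ then 1 else 0
  | s :: l, ν => ∑ κ ∈ s.steps ν, chainCount τ l κ

theorem chainCount_of_not_le {τ : YoungDiagram} (l : List Strip) {ν : YoungDiagram} (h : ¬τ ≤ ν) :
    chainCount τ l ν = 0 := by
  induction l generalizing ν with
  | nil => exact if_neg fun e => h e.ge
  | cons s l ih =>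
    refine Finset.sum_eq_zero fun κ hκ => ih fun h' => h (h'.trans ?_)
    exact (Strip.mem_steps.1 hκ).le

/-- A target τ from which alone `s` leads to ⊥ can be traded for one more strip at the end of the
chain. This turns the inner shape of a skew diagram into a strip that can be moved. -/
theorem chainCount_concat {s : Strip} {τ : YoungDiagram} (h : ∀ ν, s.IsStep ν ⊥ ↔ ν = τ)
    (l : List Strip) (ν : YoungDiagram) : chainCount ⊥ (l ++ [s]) ν = chainCount τ l ν := by
  induction l generalizing ν with
  | nil =>
    classical
    change (∑ κ ∈ s.steps ν, if κ = ⊥ then 1 else 0) = if ν = τ then 1 else 0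
    simp only [Finset.sum_ite_eq', Strip.mem_steps, h]
  | cons t l ih => exact Finset.sum_congr rfl fun κ _ => ih κ

/-- Removing `s` and then `t` can be done in as many ways as removing `t` and then `s`. -/
def Strip.Commutes (s t : Strip) : Prop :=
  ∀ ν σ, {κ | s.IsStep ν κ ∧ t.IsStep κ σ}.ncard = {κ | t.IsStep ν κ ∧ s.IsStep κ σ}.ncard

theorem Strip.commutes_hor_hor (a b : ℕ) : (hor a).Commutes (hor b) :=
  fun ν σ => ncard_hStrip_hStrip ν σ a b

theorem Strip.commutes_hor_ver (a b : ℕ) : (hor a).Commutes (ver b) :=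
  fun ν σ => ncard_hStrip_vStrip ν σ a b

/-- Grouping by the diagram left after two removals isolates the number of intermediate diagrams,
which is what `Strip.Commutes` compares. -/
theorem chainCount_cons_cons (τ : YoungDiagram) (s t : Strip) (l : List Strip)
    (ν : YoungDiagram) : chainCount τ (s :: t :: l) ν =
      ∑ σ ∈ ν.finite_le.toFinset, {κ | s.IsStep ν κ ∧ t.IsStep κ σ}.ncard * chainCount τ l σ := by
  classical
  simp only [chainCount]
  rw [Finset.sum_comm' (s' := fun σ => (s.steps ν).filter fun κ => t.IsStep κ σ)
    (t' := ν.finite_le.toFinset)]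
  · refine Finset.sum_congr rfl fun σ _ => ?_
    rw [Finset.sum_const, smul_eq_mul, ← Set.ncard_coe_finset]
    congr 2
    ext κ
    simp
  · intro κ σ
    simp only [Strip.mem_steps, Finset.mem_filter, Set.Finite.mem_toFinset]
    constructor
    · exact fun h => ⟨h, h.2.le.trans h.1.le⟩
    · exact fun h => h.1

theorem chainCount_swap {s t : Strip} (h : s.Commutes t) (τ : YoungDiagram) (l : List Strip)
    (ν : YoungDiagram) : chainCount τ (s :: t :: l) ν = chainCount τ (t :: s :: l) ν := by
  rw [chainCount_cons_cons, chainCount_cons_cons]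
  exact Finset.sum_congr rfl fun σ _ => by rw [h]

/-- This is the symmetry of skew Schur functions, in terms of chains. -/
theorem chainCount_perm (τ : YoungDiagram) {l l' : List ℕ} (h : l.Perm l') (ν : YoungDiagram) :
    chainCount τ (l.map .hor) ν = chainCount τ (l'.map .hor) ν := by
  induction h generalizing ν with
  | nil => rfl
  | cons a _ ih => exact Finset.sum_congr rfl fun κ _ => ih κ
  | swap a b l => exact chainCount_swap (Strip.commutes_hor_hor _ _) _ _ _
  | trans _ _ ih ih' => exact (ih ν).trans (ih' ν)

theorem chainCount_move (τ : YoungDiagram) (s : Strip) (l : List Strip)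
    (h : ∀ t ∈ l, t.Commutes s) (ν : YoungDiagram) :
    chainCount τ (l ++ [s]) ν = chainCount τ (s :: l) ν := by
  induction l generalizing ν with
  | nil => rfl
  | cons t l ih =>
    rw [← chainCount_swap (h t List.mem_cons_self)]
    exact Finset.sum_congr rfl fun κ _ => ih (fun u hu => h u (List.mem_cons_of_mem _ hu)) κ

/-! ### Tableaux as chains of horizontal strips -/

/-- The letters `N - 1, …, 0`, each with its multiplicity in `c`. -/
def multiplicities (c : ℕ → ℕ) (N : ℕ) : List ℕ := (List.range N).reverse.map c

theorem multiplicities_succ (c : ℕ → ℕ) (N : ℕ) :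
    multiplicities c (N + 1) = c N :: multiplicities c N := by
  simp [multiplicities, List.range_succ]

theorem multiplicities_congr {c c' : ℕ → ℕ} {N : ℕ} (h : ∀ i < N, c i = c' i) :
    multiplicities c N = multiplicities c' N :=
  List.map_congr_left fun i hi => h i (by simpa using hi)

theorem multiplicities_reflect (c : ℕ → ℕ) (N : ℕ) :
    (multiplicities (fun i => c (N - 1 - i)) N).Perm (multiplicities c N) := by
  have : ((List.range N).map fun i => N - 1 - i).Perm (List.range N) := by
    rw [List.perm_ext_iff_of_nodup _ List.nodup_range]
    · intro a
      simp only [List.mem_map, List.mem_range]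
      exact ⟨by rintro ⟨b, hb, rfl⟩; omega, fun h => ⟨N - 1 - a, by omega, by omega⟩⟩
    · rw [List.nodup_map_iff_inj_on List.nodup_range]
      intro a ha b hb h
      simp only [List.mem_range] at ha hb
      omega
  calc (multiplicities (fun i => c (N - 1 - i)) N).Perm
        ((List.range N).map fun i => c (N - 1 - i)) := (List.reverse_perm _).map _
    _ = ((List.range N).map fun i => N - 1 - i).map c := by simp [Function.comp_def]
    List.Perm _ ((List.range N).map c) := this.map c
    List.Perm _ (multiplicities c N) := ((List.reverse_perm _).map _).symm

/-- A filling of boxes, placed at the positions `pos`, is semistandard. -/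
def IsTableau {P : Type*} (pos : P → ℕ × ℕ) (f : P → ℕ) : Prop :=
  (∀ p q, (pos p).1 = (pos q).1 → (pos p).2 < (pos q).2 → f p ≤ f q) ∧
    ∀ p q, (pos p).2 = (pos q).2 → (pos p).1 < (pos q).1 → f p < f q

/-- The semistandard fillings with content `m` of boxes placed at the positions `pos`. -/
def tableaux {P : Type*} [Fintype P] (pos : P → ℕ × ℕ) (m : ℕ →₀ ℕ) : Set (P → ℕ) :=
  {f | IsTableau pos f ∧ ∑ p, Finsupp.single (f p) 1 = m}

theorem apply_mem_support_of_sum_single {P : Type*} {s : Finset P} {f : P → ℕ} {m : ℕ →₀ ℕ}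
    (h : ∑ p ∈ s, Finsupp.single (f p) 1 = m) {p : P} (hp : p ∈ s) : m (f p) ≠ 0 := by
  subst h
  rw [Finsupp.finsetSum_apply]
  have h := Finset.single_le_sum
    (f := fun q => (Finsupp.single (f q) 1 : ℕ →₀ ℕ) (f p)) (fun q _ => Nat.zero_le _) hp
  simp only [Finsupp.single_eq_same] at h
  omega

theorem finite_sum_single (P : Type*) [Fintype P] (m : ℕ →₀ ℕ) :
    {f : P → ℕ | ∑ p, Finsupp.single (f p) 1 = m}.Finite := by
  refine (Set.Finite.pi' fun _ : P => m.support.finite_toSet).subset ?_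
  intro f hf p
  exact Finsupp.mem_support_iff.2 (apply_mem_support_of_sum_single hf (Finset.mem_univ p))

theorem finite_tableaux {P : Type*} [Fintype P] (pos : P → ℕ × ℕ) (m : ℕ →₀ ℕ) :
    (tableaux pos m).Finite :=
  (finite_sum_single P m).subset fun _ h => h.2

/-- The coefficients of a skew Schur function, with the boxes indexed by any type. -/
theorem skewSchur_apply {P : Type*} [Fintype P] {pos : P → ℕ × ℕ} (hpos : Function.Injective pos)
    {D : Finset (ℕ × ℕ)} (hD : ∀ x, x ∈ D ↔ ∃ p, pos p = x) (m : ℕ →₀ ℕ) :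
    skewSchur D m = ((tableaux pos m).ncard : ℤ) := by
  let e : P ≃ D := Equiv.ofBijective (fun p => ⟨pos p, (hD _).2 ⟨p, rfl⟩⟩)
    ⟨fun p q h => hpos (congrArg Subtype.val h), fun x => by
      obtain ⟨p, hp⟩ := (hD x).1 x.2
      exact ⟨p, Subtype.ext hp⟩⟩
  have he : ∀ x : D, pos (e.symm x) = x.1 := fun x => by
    conv_rhs => rw [← e.apply_symm_apply x]
    rfl
  change ((Nat.card {T : SkewSSYT D // T.content = m} : ℕ) : ℤ) = _
  rw [← Nat.card_coe_set_eq]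
  congr 1
  refine Nat.card_congr ⟨fun T => ⟨fun p => T.1.entry (e p), ⟨?_, ?_⟩, ?_⟩,
    fun f => ⟨⟨fun x => f.1 (e.symm x), ?_, ?_⟩, ?_⟩, ?_, ?_⟩
  · exact fun p q h h' => T.1.row_weak _ _ h h'
  · exact fun p q h h' => T.1.col_strict _ _ h h'
  · refine Eq.trans ?_ T.2
    exact Equiv.sum_comp e fun x => Finsupp.single (T.1.entry x) 1
  · exact fun x y h h' => f.2.1.1 _ _ (by simpa only [he] using h) (by simpa only [he] using h')
  · exact fun x y h h' => f.2.1.2 _ _ (by simpa only [he] using h) (by simpa only [he] using h')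
  · refine Eq.trans ?_ f.2.2
    exact Equiv.sum_comp e.symm fun x => Finsupp.single (f.1 x) 1
  · rintro ⟨⟨a, _, _⟩, _⟩
    simp
  · rintro ⟨a, _⟩
    simp

/-- The semistandard fillings of `D` with content `m`, extended by `0` outside `D`. -/
def tableauxOn (D : Finset (ℕ × ℕ)) (m : ℕ →₀ ℕ) : Set (ℕ × ℕ → ℕ) :=
  {f | (∀ p ∉ D, f p = 0) ∧
    ((∀ p ∈ D, ∀ q ∈ D, p.1 = q.1 → p.2 < q.2 → f p ≤ f q) ∧
      ∀ p ∈ D, ∀ q ∈ D, p.2 = q.2 → p.1 < q.1 → f p < f q) ∧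
    ∑ p ∈ D, Finsupp.single (f p) 1 = m}

/-- Extending by zero makes fillings of different diagrams functions on one type, so that passing to
a smaller diagram needs no transport between subtypes. -/
theorem image_tableauxOn (D : Finset (ℕ × ℕ)) (m : ℕ →₀ ℕ) :
    D.restrict '' tableauxOn D m = tableaux (Subtype.val : D → ℕ × ℕ) m := by
  classical
  ext g
  constructor
  · rintro ⟨f, ⟨-, ⟨h1, h2⟩, h3⟩, rfl⟩
    refine ⟨⟨fun p q => h1 _ p.2 _ q.2, fun p q => h2 _ p.2 _ q.2⟩, ?_⟩
    rw [← h3, ← Finset.sum_attach D]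
    rfl
  · rintro ⟨⟨h1, h2⟩, h3⟩
    have hg : D.restrict (fun p => if h : p ∈ D then g ⟨p, h⟩ else 0) = g := by
      ext p
      simp
    refine ⟨fun p => if h : p ∈ D then g ⟨p, h⟩ else 0, ⟨fun p hp => by simp [hp], ⟨?_, ?_⟩, ?_⟩, hg⟩
    · intro p hp q hq
      simp only [hp, hq, dif_pos]
      exact h1 ⟨p, hp⟩ ⟨q, hq⟩
    · intro p hp q hq
      simp only [hp, hq, dif_pos]
      exact h2 ⟨p, hp⟩ ⟨q, hq⟩
    · rw [← h3, ← Finset.sum_attach D]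
      refine Finset.sum_congr rfl fun p _ => ?_
      simp

theorem injOn_restrict_tableauxOn (D : Finset (ℕ × ℕ)) (m : ℕ →₀ ℕ) :
    Set.InjOn D.restrict (tableauxOn D m) := by
  intro f hf g hg h
  ext p
  by_cases hp : p ∈ D
  · exact congrFun h ⟨p, hp⟩
  · rw [hf.1 p hp, hg.1 p hp]

theorem finite_tableauxOn (D : Finset (ℕ × ℕ)) (m : ℕ →₀ ℕ) : (tableauxOn D m).Finite :=
  Set.Finite.of_finite_image (by rw [image_tableauxOn]; exact finite_tableaux _ _)
    (injOn_restrict_tableauxOn D m)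

theorem skewSchur_eq_ncard_tableauxOn (D : Finset (ℕ × ℕ)) (m : ℕ →₀ ℕ) :
    skewSchur D m = ((tableauxOn D m).ncard : ℤ) := by
  rw [skewSchur_apply (pos := (Subtype.val : D → ℕ × ℕ)) Subtype.val_injective (by simp),
    ← image_tableauxOn, (injOn_restrict_tableauxOn D m).ncard_image]

/-- The cells that contain letters smaller than `N` form a Young diagram, and the cells that
contain `N` a horizontal strip. -/
theorem exists_subdiagram {τ ν : YoungDiagram} (hle : τ ≤ ν) {N : ℕ} {m : ℕ →₀ ℕ}
    (hm : ∀ i, N < i → m i = 0) {f : ℕ × ℕ → ℕ} (hf : f ∈ tableauxOn (ν.cells \ τ.cells) m) :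
    ∃ κ : YoungDiagram, τ ≤ κ ∧ HStrip ν κ ∧ ∀ p, p ∈ κ ↔ p ∈ ν ∧ (p ∈ τ ∨ f p < N) := by
  classical
  obtain ⟨-, ⟨h1, h2⟩, h3⟩ := hf
  simp only [Finset.mem_sdiff, mem_cells] at h1 h2
  have hN : ∀ p, p ∈ ν → p ∉ τ → f p ≤ N := by
    intro p hp hp'
    by_contra! h
    exact apply_mem_support_of_sum_single h3 (p := p) (by simp [hp, hp']) (hm _ h)
  let κ : YoungDiagram :=
    { cells := ν.cells.filter fun p => p ∈ τ ∨ f p < N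
      isLowerSet := by
        rintro ⟨i', j'⟩ ⟨i, j⟩ ⟨hi, hj⟩ h
        simp only [Finset.coe_filter, mem_cells, Set.mem_ofPred_eq] at h ⊢
        simp only at hi hj
        obtain ⟨h', h⟩ := h
        have hν : (i, j) ∈ ν := ν.up_left_mem hi hj h'
        refine ⟨hν, ?_⟩
        by_cases hτ : (i, j) ∈ τ
        · exact Or.inl hτ
        right
        have hτ' : (i', j') ∉ τ := fun h => hτ (τ.up_left_mem hi hj h)
        have hτ'' : (i, j') ∉ τ := fun h => hτ (τ.up_left_mem le_rfl hj h)
        have hν' : (i, j') ∈ ν := ν.up_left_mem hi le_rfl h'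
        -- The two boxes are compared through the corner (i, j'): along the row, then down the
        -- column.
        have a1 : f (i, j) ≤ f (i, j') := by
          rcases hj.lt_or_eq with hj | rfl
          · exact h1 _ ⟨hν, hτ⟩ _ ⟨hν', hτ''⟩ rfl hj
          · rfl
        have a2 : f (i, j') ≤ f (i', j') := by
          rcases hi.lt_or_eq with hi | rfl
          · exact (h2 _ ⟨hν', hτ''⟩ _ ⟨h', hτ'⟩ rfl hi).le
          · rfl
        have := h.resolve_left hτ'
        omega }
  have hκ : ∀ p, p ∈ κ ↔ p ∈ ν ∧ (p ∈ τ ∨ f p < N) := fun p => by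
    change p ∈ ν.cells.filter (fun p => p ∈ τ ∨ f p < N) ↔ _
    simp
  refine ⟨κ, fun p hp => (hκ p).2 ⟨hle hp, Or.inl hp⟩, fun i => ⟨?_, ?_⟩, hκ⟩
  · exact le_iff_rowLen.1 (fun p hp => ((hκ p).1 hp).1) i
  · refine le_of_forall_lt fun j hj => ?_
    have hν' : (i + 1, j) ∈ ν := mem_iff_lt_rowLen.2 hj
    have hν : (i, j) ∈ ν := ν.up_left_mem i.le_succ le_rfl hν'
    refine mem_iff_lt_rowLen.1 ((hκ _).2 ⟨hν, ?_⟩)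
    by_cases hτ : (i, j) ∈ τ
    · exact Or.inl hτ
    have hτ' : (i + 1, j) ∉ τ := fun h => hτ (τ.up_left_mem i.le_succ le_rfl h)
    have := h2 _ ⟨hν, hτ⟩ _ ⟨hν', hτ'⟩ rfl i.lt_succ_self
    have := hN _ hν' hτ'
    exact Or.inr (by omega)

theorem sum_single_sdiff {τ κ ν : YoungDiagram} (h : τ ≤ κ) (h' : κ ≤ ν) (f : ℕ × ℕ → ℕ) {N : ℕ}
    (hf : ∀ p ∈ ν, p ∉ κ → f p = N) :
    ∑ p ∈ ν.cells \ τ.cells, Finsupp.single (f p) 1 =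
      ∑ p ∈ κ.cells \ τ.cells, Finsupp.single (f p) 1 + Finsupp.single N (ν.card - κ.card) := by
  have hsub : κ.cells \ τ.cells ⊆ ν.cells \ τ.cells :=
    Finset.sdiff_subset_sdiff h' (Finset.Subset.refl _)
  have hs : (ν.cells \ τ.cells) \ (κ.cells \ τ.cells) = ν.cells \ κ.cells := by
    ext p
    simp only [Finset.mem_sdiff, mem_cells]
    have := @h p
    tauto
  rw [← Finset.sum_sdiff hsub, hs, add_comm]
  congr 1
  rw [Finset.sum_congr rfl (g := fun _ => Finsupp.single N 1), Finset.sum_const,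
    Finset.card_sdiff_of_subset h']
  · simp
  · intro p hp
    simp only [Finset.mem_sdiff, mem_cells] at hp
    rw [hf p hp.1 hp.2]

/-- Deleting the boxes that contain the largest letter `N` and filling ν/κ with `N` are inverse
operations. -/
theorem ncard_tableauxOn_fiber {τ κ ν : YoungDiagram} (hτκ : τ ≤ κ) (hκν : HStrip ν κ) {N : ℕ}
    {m : ℕ →₀ ℕ} (hm : ∀ i, N < i → m i = 0) (hcard : ν.card = κ.card + m N) :
    {f | f ∈ tableauxOn (ν.cells \ τ.cells) m ∧
      ∀ p, p ∈ κ ↔ p ∈ ν ∧ (p ∈ τ ∨ f p < N)}.ncard =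
      (tableauxOn (κ.cells \ τ.cells) (m.erase N)).ncard := by
  classical
  have hκ : κ ≤ ν := hκν.le
  have hmN : m = m.erase N + Finsupp.single N (m N) := by
    rw [add_comm, Finsupp.single_add_erase]
  have hN : ∀ f ∈ tableauxOn (ν.cells \ τ.cells) m, (∀ p, p ∈ κ ↔ p ∈ ν ∧ (p ∈ τ ∨ f p < N)) →
      ∀ p ∈ ν, p ∉ κ → f p = N := by
    rintro f ⟨-, -, h3⟩ hf p hp hp'
    have hp'' : p ∉ τ := fun h => hp' (hτκ h)
    have : ¬N < f p := fun h =>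
      apply_mem_support_of_sum_single h3 (p := p) (by simp [hp, hp'']) (hm _ h)
    have := (hf p).not.1 hp'
    simp only [hp, true_and, hp'', false_or] at this
    omega
  refine Set.ncard_congr (fun f _ p => if p ∈ κ then f p else 0) ?_ ?_ ?_
  · rintro f ⟨hf, hfκ⟩
    have hfN := hN f hf hfκ
    obtain ⟨h0, ⟨h1, h2⟩, h3⟩ := hf
    simp only [Finset.mem_sdiff, mem_cells] at h0 h1 h2
    refine ⟨?_, ⟨?_, ?_⟩, ?_⟩
    · intro p hp
      simp only [Finset.mem_sdiff, mem_cells, not_and_or, not_not] at hp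
      beta_reduce
      by_cases hpκ : p ∈ κ
      · rw [if_pos hpκ]
        exact h0 p fun h => h.2 (hp.resolve_left (not_not.2 hpκ))
      · rw [if_neg hpκ]
    · intro p hp q hq
      simp only [Finset.mem_sdiff, mem_cells] at hp hq
      beta_reduce
      rw [if_pos hp.1, if_pos hq.1]
      exact h1 p ⟨hκ hp.1, hp.2⟩ q ⟨hκ hq.1, hq.2⟩
    · intro p hp q hq
      simp only [Finset.mem_sdiff, mem_cells] at hp hq
      beta_reduce
      rw [if_pos hp.1, if_pos hq.1]
      exact h2 p ⟨hκ hp.1, hp.2⟩ q ⟨hκ hq.1, hq.2⟩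
    · rw [sum_single_sdiff hτκ hκ f hfN, hcard, Nat.add_sub_cancel_left] at h3
      rw [Finset.sum_congr rfl (g := fun p => Finsupp.single (f p) 1)]
      · exact add_right_cancel (h3.trans hmN)
      · intro p hp
        simp only [Finset.mem_sdiff, mem_cells] at hp
        beta_reduce
        rw [if_pos hp.1]
  · rintro f g ⟨hf, hfκ⟩ ⟨hg, hgκ⟩ h
    ext p
    by_cases hpκ : p ∈ κ
    · have := congrFun h p
      simpa only [if_pos hpκ] using this
    · by_cases hpν : p ∈ ν
      · rw [hN f hf hfκ p hpν hpκ, hN g hg hgκ p hpν hpκ]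
      · rw [hf.1 p (by simp [hpν]), hg.1 p (by simp [hpν])]
  · rintro g ⟨h0, ⟨h1, h2⟩, h3⟩
    simp only [Finset.mem_sdiff, mem_cells] at h0 h1 h2
    have hgN : ∀ p ∈ κ, p ∉ τ → g p < N := by
      intro p hp hp'
      have h := apply_mem_support_of_sum_single h3 (p := p) (by simp [hp, hp'])
      rcases lt_trichotomy (g p) N with h' | h' | h'
      · exact h'
      · rw [h', Finsupp.erase_same] at h
        exact absurd rfl h
      · rw [Finsupp.erase_ne (by omega), hm _ h'] at h
        exact absurd rfl h
    set f : ℕ × ℕ → ℕ := fun p => if p ∈ κ then g p else if p ∈ ν then N else 0 with hf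
    have f1 : ∀ p ∈ κ, f p = g p := fun p hp => by simp only [hf, if_pos hp]
    have f2 : ∀ p ∈ ν, p ∉ κ → f p = N := fun p hp hp' => by
      simp only [hf, if_neg hp', if_pos hp]
    have f3 : ∀ p ∉ ν, f p = 0 := fun p hp => by
      simp only [hf, if_neg hp, if_neg fun h => hp (hκ h)]
    have fN : ∀ p ∈ ν, p ∉ τ → f p ≤ N := by
      intro p hp hp'
      by_cases hpκ : p ∈ κ
      · rw [f1 p hpκ]
        exact (hgN p hpκ hp').le
      · rw [f2 p hp hpκ]
    refine ⟨f, ⟨⟨?_, ⟨?_, ?_⟩, ?_⟩, ?_⟩, ?_⟩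
    · intro p hp
      simp only [Finset.mem_sdiff, mem_cells, not_and_or, not_not] at hp
      rcases hp with hp | hp
      · exact f3 p hp
      · rw [f1 p (hτκ hp)]
        exact h0 p fun h => h.2 hp
    · rintro ⟨i, j⟩ hp ⟨i', j'⟩ hq (rfl : i = i') (hj : j < j')
      simp only [Finset.mem_sdiff, mem_cells] at hp hq
      by_cases hqκ : (i, j') ∈ κ
      · have hpκ : (i, j) ∈ κ := κ.up_left_mem le_rfl hj.le hqκ
        rw [f1 _ hqκ, f1 _ hpκ]
        exact h1 _ ⟨hpκ, hp.2⟩ _ ⟨hqκ, hq.2⟩ rfl hj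
      · rw [f2 _ hq.1 hqκ]
        exact fN _ hp.1 hp.2
    · rintro ⟨i, j⟩ hp ⟨i', j'⟩ hq (rfl : j = j') (hi : i < i')
      simp only [Finset.mem_sdiff, mem_cells] at hp hq
      -- As ν/κ is a horizontal strip, every box above a box of ν lies in κ; hence no column
      -- contains `N` twice.
      have hpκ : (i, j) ∈ κ := mem_iff_lt_rowLen.2
        ((mem_iff_lt_rowLen.1 (ν.up_left_mem (Nat.succ_le_of_lt hi) le_rfl hq.1)).trans_le (hκν i).2)
      by_cases hqκ : (i', j) ∈ κ
      · rw [f1 _ hqκ, f1 _ hpκ]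
        exact h2 _ ⟨hpκ, hp.2⟩ _ ⟨hqκ, hq.2⟩ rfl hi
      · rw [f2 _ hq.1 hqκ, f1 _ hpκ]
        exact hgN _ hpκ hp.2
    · rw [sum_single_sdiff hτκ hκ f f2, hcard, Nat.add_sub_cancel_left]
      conv_rhs => rw [hmN, ← h3]
      congr 1
      refine Finset.sum_congr rfl fun p hp => ?_
      simp only [Finset.mem_sdiff, mem_cells] at hp
      rw [f1 p hp.1]
    · intro p
      constructor
      · intro hp
        refine ⟨hκ hp, ?_⟩
        by_cases hpτ : p ∈ τ
        · exact Or.inl hpτ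
        · rw [f1 p hp]
          exact Or.inr (hgN p hp hpτ)
      · rintro ⟨hp, hpτ | hlt⟩
        · exact hτκ hpτ
        · by_contra hpκ
          rw [f2 p hp hpκ] at hlt
          exact lt_irrefl _ hlt
    · ext p
      by_cases hpκ : p ∈ κ
      · simp only [if_pos hpκ, f1 p hpκ]
      · simp only [if_neg hpκ]
        exact (h0 p fun h => hpκ h.1).symm

/-- Semistandard tableaux of skew shape correspond to chains of horizontal strips. -/
theorem ncard_tableauxOn_sdiff {τ ν : YoungDiagram} (hle : τ ≤ ν) (N : ℕ) (m : ℕ →₀ ℕ)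
    (hm : ∀ i, N ≤ i → m i = 0) :
    (tableauxOn (ν.cells \ τ.cells) m).ncard =
      chainCount τ ((multiplicities m N).map .hor) ν := by
  classical
  induction N generalizing ν m with
  | zero =>
    have hm0 : m = 0 := Finsupp.ext fun i => hm i (Nat.zero_le i)
    subst hm0
    change _ = if ν = τ then 1 else 0
    split_ifs with h
    · subst h
      rw [Set.ncard_eq_one]
      refine ⟨fun _ => 0, ?_⟩
      ext f
      simp only [tableauxOn, Finset.sdiff_self, Set.mem_ofPred_eq, Set.mem_singleton_iff]
      constructor
      · exact fun h => funext fun p => h.1 p (by simp)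
      · rintro rfl
        simp
    · rw [Set.ncard_eq_zero (finite_tableauxOn _ _), Set.eq_empty_iff_forall_notMem]
      rintro f ⟨-, -, h3⟩
      refine h (le_antisymm (fun p hp => ?_) hle)
      by_contra hp'
      exact apply_mem_support_of_sum_single h3 (p := p) (Finset.mem_sdiff.2 ⟨hp, hp'⟩) rfl
  | succ N ih =>
    rw [multiplicities_succ, List.map_cons]
    have hm' : ∀ i, N < i → m i = 0 := fun i hi => hm i hi
    -- The tableaux are sorted by the subdiagram `φ f` carrying the letters below `N`; each class is
    -- counted by the induction hypothesis for the content without `N`.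
    choose! φ hφ using fun f hf => exists_subdiagram hle hm' (f := f) hf
    have hfin := finite_tableauxOn (ν.cells \ τ.cells) m
    rw [Set.ncard_eq_toFinset_card _ hfin, Finset.card_eq_sum_card_fiberwise (f := φ)
      (t := (Strip.hor (m N)).steps ν)]
    · refine Finset.sum_congr rfl fun κ hκ => ?_
      rw [Strip.mem_steps] at hκ
      by_cases hτκ : τ ≤ κ
      · rw [multiplicities_congr (c' := m.erase N), ← ih hτκ,
          ← ncard_tableauxOn_fiber hτκ hκ.1 hm' hκ.2, ← Set.ncard_coe_finset]
        · congr 1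
          ext f
          simp only [Finset.coe_filter, Set.Finite.mem_toFinset, Set.mem_ofPred_eq]
          refine and_congr_right fun hf => ⟨?_, fun h => ?_⟩
          · rintro rfl
            exact (hφ f hf).2.2
          · exact SetLike.ext fun p => ((hφ f hf).2.2 p).trans (h p).symm
        · intro i hi
          rcases hi.lt_or_eq with hi | rfl
          · rw [Finsupp.erase_ne (by omega)]
            exact hm i hi
          · exact Finsupp.erase_same
        · exact fun i hi => (Finsupp.erase_ne (by omega)).symm
      · rw [chainCount_of_not_le _ hτκ, Finset.card_eq_zero, Finset.filter_eq_empty_iff]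
        intro f hf he
        refine hτκ (he ▸ (hφ f ?_).1)
        simpa using hf
    · intro f hf
      simp only [Set.Finite.coe_toFinset] at hf
      obtain ⟨h1, h2, h3⟩ := hφ f hf
      simp only [Finset.mem_coe, Strip.mem_steps]
      refine ⟨h2, ?_⟩
      have hfN : ∀ p ∈ ν, p ∉ φ f → f p = N := by
        intro p hp hp'
        have hp'' : p ∉ τ := fun h => hp' (h1 h)
        have : ¬N < f p := fun h =>
          apply_mem_support_of_sum_single hf.2.2 (p := p) (by simp [hp, hp'']) (hm' _ h)
        have := (h3 p).not.1 hp'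
        simp only [hp, true_and, hp'', false_or] at this
        omega
      have hc := hf.2.2
      rw [sum_single_sdiff h1 h2.le f hfN] at hc
      have hc := DFunLike.congr_fun hc N
      rw [Finsupp.add_apply, Finsupp.single_eq_same, Finsupp.finsetSum_apply,
        Finset.sum_eq_zero, zero_add] at hc
      · have : (φ f).card ≤ ν.card := Finset.card_le_card h2.le
        omega
      · intro p hp
        simp only [Finset.mem_sdiff, mem_cells] at hp
        have := ((h3 p).1 hp.1).2.resolve_left hp.2
        exact Finsupp.single_eq_of_ne (by omega)

theorem skewSchur_sdiff_apply {τ ν : YoungDiagram} (hle : τ ≤ ν) {N : ℕ} {m : ℕ →₀ ℕ}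
    (hm : ∀ i, N ≤ i → m i = 0) :
    skewSchur (ν.cells \ τ.cells) m = chainCount τ ((multiplicities m N).map .hor) ν := by
  rw [skewSchur_eq_ncard_tableauxOn, ncard_tableauxOn_sdiff hle N m hm]

theorem skewSchur_cells_apply (ν : YoungDiagram) {N : ℕ} {m : ℕ →₀ ℕ}
    (hm : ∀ i, N ≤ i → m i = 0) :
    skewSchur ν.cells m = chainCount ⊥ ((multiplicities m N).map .hor) ν := by
  rw [← skewSchur_sdiff_apply bot_le hm, cells_bot, Finset.sdiff_empty]

theorem exists_forall_ge_eq_zero (m : ℕ →₀ ℕ) : ∃ N, ∀ i, N ≤ i → m i = 0 := by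
  obtain ⟨N, hN⟩ := m.support.bddAbove
  refine ⟨N + 1, fun i hi => ?_⟩
  by_contra h
  have := hN (Finsupp.mem_support_iff.2 h)
  omega

theorem sum_skewSchur_apply (S : Finset YoungDiagram) (m : ℕ →₀ ℕ) :
    (∑ η ∈ S, skewSchur η.cells : MvPowerSeries ℕ ℤ) m = ∑ η ∈ S, skewSchur η.cells m :=
  Finset.sum_apply m S fun η : YoungDiagram => skewSchur η.cells

/-! ### Schur expansions when the inner shape is a row or a column -/

/-- The expansion of the skew Schur function of a Young diagram without its first strip. -/
theorem skewSchur_sdiff_eq_sum {s : Strip} {τ ν : YoungDiagram} (h : ∀ ν, s.IsStep ν ⊥ ↔ ν = τ)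
    (hs : ∀ c, (Strip.hor c).Commutes s) (hle : τ ≤ ν) :
    skewSchur (ν.cells \ τ.cells) = ∑ κ ∈ s.steps ν, skewSchur κ.cells := by
  funext m
  obtain ⟨N, hN⟩ := exists_forall_ge_eq_zero m
  -- The inner shape becomes a final strip `s`, which is moved to the front past the horizontal
  -- strips of the letters. The remaining chains from κ to ⊥ count tableaux of straight shape.
  rw [sum_skewSchur_apply, skewSchur_sdiff_apply hle hN, ← chainCount_concat h, chainCount_move]
  · change ((∑ κ ∈ s.steps ν, chainCount ⊥ _ κ : ℕ) : ℤ) = _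
    rw [Nat.cast_sum]
    exact Finset.sum_congr rfl fun κ _ => (skewSchur_cells_apply κ hN).symm
  · intro t ht
    obtain ⟨c, -, rfl⟩ := List.mem_map.1 ht
    exact hs c

theorem rowLen_bot (i : ℕ) : (⊥ : YoungDiagram).rowLen i = 0 := by
  by_contra h
  exact notMem_bot (i, 0) (mem_iff_lt_rowLen.2 (Nat.pos_of_ne_zero h))

theorem card_bot : (⊥ : YoungDiagram).card = 0 := rfl

theorem isStep_hor_bot_iff {j : ℕ} {τ : YoungDiagram}
    (hτ : ∀ i, τ.rowLen i = if i = 0 then j else 0) (ν : YoungDiagram) :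
    (Strip.hor j).IsStep ν ⊥ ↔ ν = τ := by
  constructor
  · rintro ⟨h, hc⟩
    have h1 : ν.rowLen 1 = 0 := by
      have := (h 0).2
      rw [rowLen_bot] at this
      exact Nat.le_zero.1 this
    rw [ν.card_eq_sum_rowLen h1, Finset.sum_range_one, card_bot, zero_add] at hc
    refine ext_rowLen fun i => ?_
    rw [hτ]
    split_ifs with hi
    · subst hi
      exact hc
    · have := ν.rowLen_anti 1 i (by omega)
      omega
  · rintro rfl
    refine ⟨fun i => ⟨by rw [rowLen_bot]; omega, by rw [rowLen_bot, hτ, if_neg (by omega)]⟩, ?_⟩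
    rw [ν.card_eq_sum_rowLen (N := 1) (by rw [hτ, if_neg (by omega)]), Finset.sum_range_one, hτ]
    simp

theorem isStep_ver_bot_iff {M : ℕ} {τ : YoungDiagram}
    (hτ : ∀ i, τ.rowLen i = if i < M then 1 else 0) (ν : YoungDiagram) :
    (Strip.ver M).IsStep ν ⊥ ↔ ν = τ := by
  constructor
  · rintro ⟨h, hc⟩
    have h1 : ∀ i, ν.rowLen i = if i < ν.colLen 0 then 1 else 0 := by
      intro i
      have h1 := (h i).2
      rw [rowLen_bot] at h1
      have h2 : 0 < ν.rowLen i ↔ i < ν.colLen 0 := by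
        rw [← mem_iff_lt_rowLen, mem_iff_lt_colLen]
      split_ifs <;> omega
    rw [ν.card_eq_sum_rowLen (rowLen_eq_zero le_rfl), Finset.sum_congr rfl (g := fun _ => 1)] at hc
    · have hM : ν.colLen 0 = M := by simpa [card_bot] using hc
      refine ext_rowLen fun i => ?_
      rw [h1, hτ, hM]
    · intro i hi
      rw [h1, if_pos (Finset.mem_range.1 hi)]
  · rintro rfl
    refine ⟨fun i => ?_, ?_⟩
    · rw [rowLen_bot, hτ]
      split_ifs <;> omega
    · rw [ν.card_eq_sum_rowLen (N := M) (by simp [hτ]), Finset.sum_congr rfl (g := fun _ => 1)]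
      · simp
      · intro i hi
        rw [hτ, if_pos (Finset.mem_range.1 hi)]

/-! ### Rotation by 180° -/

/-- The content `m` with the letters `0, …, N - 1` in reverse order. -/
noncomputable def reverseContent (N : ℕ) (m : ℕ →₀ ℕ) : ℕ →₀ ℕ :=
  m.mapDomain fun i => N - 1 - i

section reverseContent

variable {N : ℕ} {m : ℕ →₀ ℕ}

theorem reverseContent_apply (hm : ∀ i, N ≤ i → m i = 0) {i : ℕ} (hi : i < N) :
    reverseContent N m i = m (N - 1 - i) := by
  have h : i = (fun i => N - 1 - i) (N - 1 - i) := by simp only; omega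
  conv_lhs => rw [h]
  refine Finsupp.mapDomain_apply' (Set.Iio N) m ?_ ?_ ?_
  · intro j hj
    by_contra h
    exact Finsupp.mem_support_iff.1 hj (hm j (by simpa using h))
  · intro a ha b hb h
    simp only [Set.mem_Iio] at ha hb h
    omega
  · simp only [Set.mem_Iio]
    omega

theorem reverseContent_apply_of_le (hm : ∀ i, N ≤ i → m i = 0) (i : ℕ) (hi : N ≤ i) :
    reverseContent N m i = 0 := by
  classical
  by_contra h
  have := Finsupp.mapDomain_support (Finsupp.mem_support_iff.2 h)
  obtain ⟨j, hj, rfl⟩ := Finset.mem_image.1 this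
  refine Finsupp.mem_support_iff.1 hj (hm j ?_)
  omega

theorem reverseContent_reverseContent (hm : ∀ i, N ≤ i → m i = 0) :
    reverseContent N (reverseContent N m) = m := by
  ext i
  have h := reverseContent_apply_of_le hm
  by_cases hi : i < N
  · rw [reverseContent_apply h hi, reverseContent_apply hm (by omega)]
    congr 1
    omega
  · rw [reverseContent_apply_of_le h i (by omega), hm i (by omega)]

/-- Schur functions are symmetric under reversing the order of the variables. -/
theorem skewSchur_cells_reverseContent (ν : YoungDiagram) (hm : ∀ i, N ≤ i → m i = 0) :
    skewSchur ν.cells (reverseContent N m) = skewSchur ν.cells m := by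
  rw [skewSchur_cells_apply ν hm, skewSchur_cells_apply ν (reverseContent_apply_of_le hm),
    multiplicities_congr (c' := fun i => m (N - 1 - i)) fun i hi => reverseContent_apply hm hi,
    chainCount_perm _ (multiplicities_reflect _ _)]

variable {P : Type*} [Fintype P] {pos pos' : P → ℕ × ℕ} {a b : ℕ}

theorem reverse_mem_tableaux (hm : ∀ i, N ≤ i → m i = 0)
    (h : ∀ p, (pos p).1 + (pos' p).1 = a ∧ (pos p).2 + (pos' p).2 = b) {f : P → ℕ}
    (hf : f ∈ tableaux pos m) : (fun p => N - 1 - f p) ∈ tableaux pos' (reverseContent N m) := by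
  obtain ⟨⟨h1, h2⟩, h3⟩ := hf
  have hN : ∀ p, f p < N := by
    intro p
    by_contra h
    exact apply_mem_support_of_sum_single h3 (Finset.mem_univ p) (hm _ (by omega))
  refine ⟨⟨fun p q e l => ?_, fun p q e l => ?_⟩, ?_⟩
  · have := h p
    have := h q
    have := h1 q p (by omega) (by omega)
    beta_reduce
    omega
  · have := h p
    have := h q
    have := h2 q p (by omega) (by omega)
    have := hN p
    beta_reduce
    omega
  · rw [← h3, reverseContent, Finsupp.mapDomain_finsetSum]
    simp only [Finsupp.mapDomain_single]

theorem ncard_tableaux_reverse (hm : ∀ i, N ≤ i → m i = 0)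
    (h : ∀ p, (pos p).1 + (pos' p).1 = a ∧ (pos p).2 + (pos' p).2 = b) :
    (tableaux pos m).ncard = (tableaux pos' (reverseContent N m)).ncard := by
  have hlt : ∀ {pos : P → ℕ × ℕ} {m : ℕ →₀ ℕ}, (∀ i, N ≤ i → m i = 0) → ∀ f ∈ tableaux pos m,
      ∀ p, f p < N := by
    intro pos m hm f hf p
    by_contra h
    exact apply_mem_support_of_sum_single hf.2 (Finset.mem_univ p) (hm _ (by omega))
  refine Set.ncard_congr (fun f _ p => N - 1 - f p)
    (fun f hf => reverse_mem_tableaux hm h hf) ?_ ?_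
  · intro f g hf hg e
    ext p
    have := congrFun e p
    have := hlt hm f hf p
    have := hlt hm g hg p
    omega
  · intro g hg
    have hm' := reverseContent_apply_of_le hm
    refine ⟨fun p => N - 1 - g p, ?_, ?_⟩
    · have := reverse_mem_tableaux (pos' := pos) (a := a) (b := b) hm'
        (fun p => by have := h p; omega) hg
      rwa [reverseContent_reverseContent hm] at this
    · ext p
      have := hlt hm' g hg p
      beta_reduce
      omega

end reverseContent

/-- A Schur expansion of a diagram is also one of the diagram rotated by 180°. -/
theorem skewSchur_rotate {P : Type*} [Fintype P] {pos pos' : P → ℕ × ℕ} {a b : ℕ}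
    (h : ∀ p, (pos p).1 + (pos' p).1 = a ∧ (pos p).2 + (pos' p).2 = b)
    {D D' : Finset (ℕ × ℕ)} (hpos' : Function.Injective pos')
    (hD : ∀ x, x ∈ D ↔ ∃ p, pos p = x) (hD' : ∀ x, x ∈ D' ↔ ∃ p, pos' p = x)
    {S : Finset YoungDiagram} (hS : skewSchur D' = ∑ η ∈ S, skewSchur η.cells) :
    skewSchur D = ∑ η ∈ S, skewSchur η.cells := by
  have hpos : Function.Injective pos := by
    intro p q e
    apply hpos'
    have := h p
    have := h q
    rw [e] at *
    exact Prod.ext (by omega) (by omega)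
  funext m
  -- All letters are below `N`, so i ↦ N - 1 - i reverses their order. The rotated tableaux have the
  -- reversed content, to which Schur functions are insensitive.
  obtain ⟨N, hm⟩ := exists_forall_ge_eq_zero m
  rw [sum_skewSchur_apply, skewSchur_apply hpos hD, ncard_tableaux_reverse hm h,
    ← skewSchur_apply hpos' hD', hS, sum_skewSchur_apply]
  exact Finset.sum_congr rfl fun η _ => skewSchur_cells_reverseContent η hm

/-! ### A column above a Young diagram -/

/-- The Young diagram `ν`, with a column of `r` boxes above it, in column `c`. -/
def columnAbove (ν : YoungDiagram) (r c : ℕ) : Finset (ℕ × ℕ) :=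
  (Finset.range r).image (fun i => (i, c)) ∪ ν.cells.image fun x => (x.1 + r, x.2)

/-- The positions of the boxes of `columnAbove ν r c`. -/
def columnAbovePos (ν : YoungDiagram) (r c : ℕ) : ν.cells ⊕ Fin r → ℕ × ℕ :=
  Sum.elim (fun x => (x.1.1 + r, x.1.2)) fun i => (i, c)

theorem columnAbovePos_injective (ν : YoungDiagram) (r c : ℕ) :
    Function.Injective (columnAbovePos ν r c) := by
  rintro (⟨⟨i, j⟩, hx⟩ | i) (⟨⟨i', j'⟩, hy⟩ | i') h <;>
    simp only [columnAbovePos, Sum.elim_inl, Sum.elim_inr, Prod.mk.injEq] at h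
  · obtain ⟨h1, rfl⟩ := h
    obtain rfl : i = i' := by omega
    rfl
  · omega
  · omega
  · rw [Fin.ext h.1]

theorem mem_columnAbove_iff (ν : YoungDiagram) (r c : ℕ) (x : ℕ × ℕ) :
    x ∈ columnAbove ν r c ↔ ∃ p, columnAbovePos ν r c p = x := by
  rw [Sum.exists]
  simp [columnAbove, columnAbovePos, Fin.exists_iff, or_comm]

/-- For a diagram made of two pieces, only the mixed conditions depend on how the pieces lie
relative to each other. -/
theorem isTableau_sum_iff {P Q : Type*} {pos : P ⊕ Q → ℕ × ℕ} {f : P ⊕ Q → ℕ} :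
    IsTableau pos f ↔ IsTableau (pos ∘ Sum.inl) (f ∘ Sum.inl) ∧
      IsTableau (pos ∘ Sum.inr) (f ∘ Sum.inr) ∧ ∀ p q,
        ((pos (.inl p)).1 = (pos (.inr q)).1 →
          ((pos (.inl p)).2 < (pos (.inr q)).2 → f (.inl p) ≤ f (.inr q)) ∧
          ((pos (.inr q)).2 < (pos (.inl p)).2 → f (.inr q) ≤ f (.inl p))) ∧
        ((pos (.inl p)).2 = (pos (.inr q)).2 →
          ((pos (.inl p)).1 < (pos (.inr q)).1 → f (.inl p) < f (.inr q)) ∧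
          ((pos (.inr q)).1 < (pos (.inl p)).1 → f (.inr q) < f (.inl p))) := by
  constructor
  · intro h
    exact ⟨⟨fun p q => h.1 _ _, fun p q => h.2 _ _⟩, ⟨fun p q => h.1 _ _, fun p q => h.2 _ _⟩,
      fun p q => ⟨fun e => ⟨h.1 _ _ e, h.1 _ _ e.symm⟩, fun e => ⟨h.2 _ _ e, h.2 _ _ e.symm⟩⟩⟩
  · rintro ⟨h1, h2, h3⟩
    constructor
    · rintro (p | p) (q | q) e
      · exact h1.1 _ _ e
      · exact ((h3 p q).1 e).1
      · exact ((h3 q p).1 e.symm).2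
      · exact h2.1 _ _ e
    · rintro (p | p) (q | q) e
      · exact h1.2 _ _ e
      · exact ((h3 p q).2 e).1
      · exact ((h3 q p).2 e.symm).2
      · exact h2.2 _ _ e

theorem isTableau_congr {P : Type*} {pos pos' : P → ℕ × ℕ} {a b a' b' : ℕ}
    (h : ∀ p, (pos p).1 + a = (pos' p).1 + a' ∧ (pos p).2 + b = (pos' p).2 + b') (f : P → ℕ) :
    IsTableau pos f ↔ IsTableau pos' f := by
  constructor <;>
  · rintro ⟨h1, h2⟩
    refine ⟨fun p q e l => h1 p q ?_ ?_, fun p q e l => h2 p q ?_ ?_⟩ <;>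
    · have := h p
      have := h q
      omega

section columns

variable {ν : YoungDiagram} {r : ℕ}

theorem isTableau_column {c a : ℕ} {g : Fin r → ℕ} :
    IsTableau (fun i : Fin r => (a + i.1, c)) g ↔ StrictMono g := by
  constructor
  · intro h i j hij
    exact h.2 i j rfl (Nat.add_lt_add_left hij a)
  · refine fun h => ⟨fun p q _ l => absurd l (lt_irrefl _), fun p q _ l => h ?_⟩
    exact Nat.lt_of_add_lt_add_left l

/-- Fillings of a Young diagram and of a column that are both semistandard. -/
def IsTableauPair (f : ν.cells ⊕ Fin r → ℕ) : Prop :=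
  IsTableau (Subtype.val : ν.cells → ℕ × ℕ) (f ∘ Sum.inl) ∧ StrictMono (f ∘ Sum.inr)

theorem rowLen_zero_of_mem {i j : ℕ} (h : (i, j) ∈ ν) : j < ν.rowLen 0 :=
  (mem_iff_lt_rowLen.1 h).trans_le (ν.rowLen_anti 0 i (Nat.zero_le i))

theorem isTableau_columnAbovePos_inl {c : ℕ} (g : ν.cells → ℕ) :
    IsTableau (columnAbovePos ν r c ∘ Sum.inl) g ↔ IsTableau (Subtype.val : ν.cells → ℕ × ℕ) g :=
  isTableau_congr (a := 0) (a' := r) (b := 0) (b' := 0) (by exact fun _ => ⟨rfl, rfl⟩) g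

theorem isTableau_columnAbovePos_inr {c : ℕ} (g : Fin r → ℕ) :
    IsTableau (columnAbovePos ν r c ∘ Sum.inr) g ↔ StrictMono g := by
  rw [← isTableau_column (a := 0) (c := c)]
  exact isTableau_congr (a := 0) (a' := 0) (b := 0) (b' := 0) (fun _ => by simp [columnAbovePos]) g

/-- In this position the column shares no row and no column with ν, so there are no mixed
conditions. -/
theorem isTableau_disjoint_iff {f : ν.cells ⊕ Fin r → ℕ} :
    IsTableau (columnAbovePos ν r (ν.rowLen 0)) f ↔ IsTableauPair f := by
  rw [isTableau_sum_iff, isTableau_columnAbovePos_inl, isTableau_columnAbovePos_inr, ← and_assoc]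
  refine and_iff_left ?_
  rintro ⟨⟨i, j⟩, hx⟩ q
  have := rowLen_zero_of_mem hx
  simp only [columnAbovePos, Sum.elim_inl, Sum.elim_inr]
  omega

/-- The bottom of the column sits directly on the last box of the first row. Monotonicity within
both pieces reduces all mixed conditions to this pair. -/
theorem isTableau_attached_iff {f : ν.cells ⊕ Fin (r + 1) → ℕ} (h0 : (0, ν.rowLen 0 - 1) ∈ ν.cells) :
    IsTableau (columnAbovePos ν (r + 1) (ν.rowLen 0 - 1)) f ↔
      IsTableauPair f ∧ f (.inr (Fin.last r)) < f (.inl ⟨_, h0⟩) := by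
  rw [isTableau_sum_iff, isTableau_columnAbovePos_inl, isTableau_columnAbovePos_inr, ← and_assoc]
  refine and_congr_right fun hf => ⟨fun h => ?_, fun h => ?_⟩
  · refine ((h _ _).2 rfl).2 ?_
    simp [columnAbovePos]
  · rintro ⟨⟨i, j⟩, hx⟩ q
    have := rowLen_zero_of_mem hx
    have hq : f (.inr q) ≤ f (.inr (Fin.last r)) := hf.2.monotone (Fin.le_last q)
    simp only [columnAbovePos, Sum.elim_inl, Sum.elim_inr]
    refine ⟨fun h => by omega, ?_⟩
    rintro rfl
    refine ⟨fun h => by omega, fun _ => ?_⟩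
    have hx' : f (.inl ⟨_, h0⟩) ≤ f (.inl ⟨_, hx⟩) := by
      rcases i.eq_zero_or_pos with rfl | hi
      · rfl
      · exact (hf.1.2 ⟨_, h0⟩ ⟨_, hx⟩ rfl hi).le
    omega

/-- The positions of the boxes of `columnAbove ν (r + 1) (ν.rowLen 0)` after moving the column one
row down. -/
def columnBesidePos (ν : YoungDiagram) (r : ℕ) : ν.cells ⊕ Fin (r + 1) → ℕ × ℕ :=
  Sum.elim (fun x => (x.1.1 + r, x.1.2)) fun i => (i, ν.rowLen 0)

theorem columnBesidePos_injective : Function.Injective (columnBesidePos ν r) := by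
  rintro (⟨⟨i, j⟩, hx⟩ | i) (⟨⟨i', j'⟩, hy⟩ | i') h <;>
    simp only [columnBesidePos, Sum.elim_inl, Sum.elim_inr, Prod.mk.injEq] at h
  · obtain ⟨h1, rfl⟩ := h
    obtain rfl : i = i' := by omega
    rfl
  · have := rowLen_zero_of_mem hx
    omega
  · have := rowLen_zero_of_mem hy
    omega
  · rw [Fin.ext h.1]

/-- Only the bottom box of the column shares a row with ν, namely the first row, and it is the right
neighbour of the last box there. -/
theorem isTableau_beside_iff {f : ν.cells ⊕ Fin (r + 1) → ℕ} (h0 : (0, ν.rowLen 0 - 1) ∈ ν.cells) :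
    IsTableau (columnBesidePos ν r) f ↔
      IsTableauPair f ∧ f (.inl ⟨_, h0⟩) ≤ f (.inr (Fin.last r)) := by
  have e1 : IsTableau (columnBesidePos ν r ∘ Sum.inl) (f ∘ Sum.inl) ↔
      IsTableau (Subtype.val : ν.cells → ℕ × ℕ) (f ∘ Sum.inl) :=
    isTableau_congr (a := 0) (a' := r) (b := 0) (b' := 0) (by exact fun _ => ⟨rfl, rfl⟩) _
  have e2 : IsTableau (columnBesidePos ν r ∘ Sum.inr) (f ∘ Sum.inr) ↔ StrictMono (f ∘ Sum.inr) := by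
    rw [← isTableau_column (a := 0) (c := ν.rowLen 0)]
    exact isTableau_congr (a := 0) (a' := 0) (b := 0) (b' := 0)
      (fun _ => by simp [columnBesidePos]) _
  rw [isTableau_sum_iff, e1, e2, ← and_assoc]
  refine and_congr_right fun hf => ⟨fun h => ?_, fun h => ?_⟩
  · refine ((h _ _).1 ?_).1 ?_
    · simp [columnBesidePos]
    · have := rowLen_zero_of_mem h0
      simp only [columnBesidePos, Sum.elim_inl, Sum.elim_inr]
      exact this
  · rintro ⟨⟨i, j⟩, hx⟩ q
    have hj := rowLen_zero_of_mem hx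
    simp only [columnBesidePos, Sum.elim_inl, Sum.elim_inr]
    refine ⟨fun h => ⟨fun _ => ?_, fun h => by omega⟩, fun h => by omega⟩
    have hq := q.2
    obtain rfl : q = Fin.last r := Fin.ext (by simp; omega)
    simp only [Fin.val_last] at h
    obtain rfl : i = 0 := by omega
    have hx' : f (.inl ⟨_, hx⟩) ≤ f (.inl ⟨_, h0⟩) := by
      rcases (Nat.le_sub_one_of_lt hj).lt_or_eq with hj | rfl
      · exact hf.1.1 ⟨_, hx⟩ ⟨_, h0⟩ rfl hj
      · rfl
    omega

/-- Let c be the letter at the bottom of the detached column and b the last letter of the first row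
of ν. If c < b, the column may be set on top of the last column; if b ≤ c, it may slide down beside
the first row. Exactly one case occurs. -/
theorem ncard_tableaux_columnAbovePos (h0 : 0 < ν.rowLen 0) (m : ℕ →₀ ℕ) :
    (tableaux (columnAbovePos ν (r + 1) (ν.rowLen 0)) m).ncard =
      (tableaux (columnAbovePos ν (r + 1) (ν.rowLen 0 - 1)) m).ncard +
        (tableaux (columnBesidePos ν r) m).ncard := by
  have h0 : (0, ν.rowLen 0 - 1) ∈ ν.cells := mem_iff_lt_rowLen.2 (by omega)
  rw [← Set.ncard_union_eq _ (finite_tableaux _ _) (finite_tableaux _ _)]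
  · congr 1
    ext f
    simp only [tableaux, Set.mem_ofPred_eq, Set.mem_union, isTableau_disjoint_iff,
      isTableau_attached_iff h0, isTableau_beside_iff h0]
    have := lt_or_ge (f (.inr (Fin.last r))) (f (.inl ⟨_, h0⟩))
    tauto
  · rw [Set.disjoint_left]
    rintro f ⟨hf, -⟩ ⟨hf', -⟩
    rw [isTableau_attached_iff h0] at hf
    rw [isTableau_beside_iff h0] at hf'
    exact absurd hf.2 (not_lt.2 hf'.2)

end columns

/-- The Young diagram `ν` with a column of the same height put to the left of it and `r` boxes put
below that column. -/
def fullColumn (ν : YoungDiagram) (r : ℕ) : YoungDiagram :=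
  ofFun (fun i => if i < ν.colLen 0 + r then ν.rowLen i + 1 else 0)
    (antitone_nat_of_succ_le fun i => by
      have := ν.rowLen_succ_le i
      split_ifs <;> omega) (ν.colLen 0 + r) (if_neg (lt_irrefl _))

theorem rowLen_fullColumn (ν : YoungDiagram) (r i : ℕ) :
    (fullColumn ν r).rowLen i = if i < ν.colLen 0 + r then ν.rowLen i + 1 else 0 :=
  rowLen_ofFun _ _ _ _ i

theorem card_fullColumn (ν : YoungDiagram) (r : ℕ) :
    (fullColumn ν r).card = ν.card + (ν.colLen 0 + r) := by
  rw [card_eq_sum_rowLen (fullColumn ν r) (N := ν.colLen 0 + r) (by simp [rowLen_fullColumn]),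
    card_eq_sum_rowLen ν (N := ν.colLen 0 + r) (rowLen_eq_zero (by omega)),
    Finset.sum_congr rfl (g := fun i => ν.rowLen i + 1)]
  · rw [Finset.sum_add_distrib]
    simp
  · intro i hi
    rw [rowLen_fullColumn, if_pos (Finset.mem_range.1 hi)]

/-- The diagrams obtained from `ν` by adding a vertical strip with `r` boxes. -/
noncomputable def addVStrip (ν : YoungDiagram) (r : ℕ) : Finset YoungDiagram :=
  (Strip.ver (ν.colLen 0)).steps (fullColumn ν r)

/-- Rows below `ν.colLen 0 + r` are one box longer in `fullColumn ν r` than in ν, so removing at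
most one box from a row is the same as adding at most one box to that row of ν. -/
theorem mem_addVStrip {ν η : YoungDiagram} {r : ℕ} :
    η ∈ addVStrip ν r ↔ VStrip η ν ∧ η.card = ν.card + r := by
  classical
  rw [addVStrip, Strip.mem_steps]
  change VStrip _ _ ∧ _ ↔ _
  rw [card_fullColumn]
  constructor
  · rintro ⟨h, hc⟩
    refine ⟨fun i => ?_, by omega⟩
    have := h i
    rw [rowLen_fullColumn] at this
    split_ifs at this with hi
    · omega
    · rw [rowLen_eq_zero (μ := ν) (by omega)]
      omega
  · rintro ⟨h, hc⟩
    refine ⟨fun i => ?_, by omega⟩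
    have hi := h i
    rw [rowLen_fullColumn]
    split_ifs with hlt
    · omega
    · refine ⟨?_, by omega⟩
      by_contra! hpos
      -- A nonempty row with index `ν.colLen 0 + r` would force r + 1 new boxes in column 0, but η
      -- has only r boxes more than ν.
      have hsub : ν.cells ∪ (Finset.Ico (ν.colLen 0) (ν.colLen 0 + r + 1)).image (fun i => (i, 0)) ⊆
          η.cells := by
        refine Finset.union_subset h.le fun p hp => ?_
        obtain ⟨a, ha, rfl⟩ := Finset.mem_image.1 hp
        rw [Finset.mem_Ico] at ha
        exact mem_iff_lt_rowLen.2 (hpos.trans_le (η.rowLen_anti _ _ (by omega)))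
      have hle := Finset.card_le_card hsub
      rw [Finset.card_union_of_disjoint, Finset.card_image_of_injective, Nat.card_Ico] at hle
      · have : η.cells.card = ν.cells.card + r := hc
        omega
      · exact fun a b e => congrArg Prod.fst e
      · rw [Finset.disjoint_left]
        intro p hp hp'
        obtain ⟨a, ha, rfl⟩ := Finset.mem_image.1 hp'
        rw [Finset.mem_Ico] at ha
        have := mem_iff_lt_colLen.1 ((mem_cells _).1 hp)
        omega

/-- The dual Pieri rule: `s_ν e_r` is the sum of the `s_η` for all vertical `r`-strips `η / ν`. -/
theorem skewSchur_columnAbove_rowLen (ν : YoungDiagram) (r : ℕ) :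
    skewSchur (columnAbove ν r (ν.rowLen 0)) = ∑ η ∈ addVStrip ν r, skewSchur η.cells := by
  set M := ν.colLen 0 with hM
  -- Without a column of height `M`, `fullColumn ν r` falls into a shifted copy of ν and a detached
  -- column of r boxes at the lower left. This has the same tableaux as ν with a detached column at
  -- the upper right.
  let τ : YoungDiagram := ofFun (fun i => if i < M then 1 else 0)
    (antitone_nat_of_succ_le fun i => by split_ifs <;> omega) M (if_neg (lt_irrefl _))
  have hτ : ∀ i, τ.rowLen i = if i < M then 1 else 0 := rowLen_ofFun _ _ _ _
  have hle : τ ≤ fullColumn ν r := le_iff_rowLen.2 fun i => by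
    rw [hτ, rowLen_fullColumn]
    split_ifs <;> omega
  rw [addVStrip, ← skewSchur_sdiff_eq_sum (isStep_ver_bot_iff hτ)
    (fun c => Strip.commutes_hor_ver c M) hle]
  let pos : ν.cells ⊕ Fin r → ℕ × ℕ := Sum.elim (fun x => (x.1.1, x.1.2 + 1)) fun i => (M + i, 0)
  have hpos : Function.Injective pos := by
    rintro (⟨⟨i, j⟩, hx⟩ | i) (⟨⟨i', j'⟩, hy⟩ | i') h <;>
      simp only [pos, Sum.elim_inl, Sum.elim_inr, Prod.mk.injEq] at h
    · obtain ⟨rfl, h1⟩ := h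
      obtain rfl : j = j' := by omega
      rfl
    · omega
    · omega
    · have : i = i' := Fin.ext (by omega)
      rw [this]
  have hD : ∀ x, x ∈ (fullColumn ν r).cells \ τ.cells ↔ ∃ p, pos p = x := by
    rintro ⟨i, j⟩
    simp only [Finset.mem_sdiff, mem_cells, mem_iff_lt_rowLen, hτ, rowLen_fullColumn, Sum.exists,
      pos, Sum.elim_inl, Sum.elim_inr, Subtype.exists, Prod.exists, Prod.mk.injEq]
    have hz : ν.rowLen i = 0 ↔ M ≤ i := by
      constructor
      · intro h
        by_contra! hlt
        have := mem_iff_lt_rowLen.1 (mem_iff_lt_colLen.2 hlt)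
        omega
      · exact rowLen_eq_zero
    constructor
    · rintro ⟨h1, h2⟩
      rcases j with _ | j
      · right
        refine ⟨⟨i - M, ?_⟩, ?_, rfl⟩
        · split_ifs at h1 h2 <;> omega
        · split_ifs at h1 h2 <;> simp only <;> omega
      · left
        refine ⟨i, j, ?_, rfl, rfl⟩
        split_ifs at h1 <;> omega
    · rintro (⟨i, j, h, rfl, rfl⟩ | ⟨a, rfl, rfl⟩)
      · have hi : i < M := by
          by_contra! h'
          have := hz.2 h'
          omega
        rw [if_pos (by omega), if_pos hi]
        omega
      · have := a.2
        rw [if_pos (by omega), if_neg (by omega)]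
        omega
  funext m
  rw [skewSchur_apply (columnAbovePos_injective ν r _) (mem_columnAbove_iff ν r _),
    skewSchur_apply hpos hD]
  congr 2
  ext f
  simp only [tableaux, Set.mem_ofPred_eq]
  refine and_congr_left fun _ => ?_
  rw [isTableau_disjoint_iff, isTableau_sum_iff, IsTableauPair, ← and_assoc]
  have e1 : IsTableau (pos ∘ Sum.inl) (f ∘ Sum.inl) ↔
      IsTableau (Subtype.val : ν.cells → ℕ × ℕ) (f ∘ Sum.inl) :=
    isTableau_congr (a := 0) (a' := 0) (b := 0) (b' := 1) (by exact fun _ => ⟨rfl, rfl⟩) _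
  have e2 : IsTableau (pos ∘ Sum.inr) (f ∘ Sum.inr) ↔ StrictMono (f ∘ Sum.inr) :=
    isTableau_column
  rw [e1, e2]
  refine (and_iff_left ?_).symm
  rintro ⟨⟨i, j⟩, hx⟩ q
  have := mem_iff_lt_colLen.1 ((mem_cells _).1 (ν.up_left_mem le_rfl (Nat.zero_le j) hx))
  simp only [pos, Sum.elim_inl, Sum.elim_inr]
  omega

/-- The Young diagram `ν` with one more box in its first row. -/
def addFirst (ν : YoungDiagram) : YoungDiagram :=
  ofFun (fun i => if i = 0 then ν.rowLen 0 + 1 else ν.rowLen i)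
    (antitone_nat_of_succ_le fun i => by
      have := ν.rowLen_anti 0 (i + 1) (by omega)
      have := ν.rowLen_succ_le i
      rw [if_neg i.succ_ne_zero]
      split_ifs <;> omega) (ν.colLen 0 + 1)
    (by rw [if_neg (by omega)]; exact rowLen_eq_zero (by omega))

theorem rowLen_addFirst (ν : YoungDiagram) (i : ℕ) :
    (addFirst ν).rowLen i = if i = 0 then ν.rowLen 0 + 1 else ν.rowLen i :=
  rowLen_ofFun _ _ _ _ i

theorem card_addFirst (ν : YoungDiagram) : (addFirst ν).card = ν.card + 1 := by
  rw [card_eq_sum_rowLen (addFirst ν) (N := ν.colLen 0 + 1)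
    (by rw [rowLen_addFirst, if_neg (by omega)]; exact rowLen_eq_zero (by omega)),
    card_eq_sum_rowLen ν (N := ν.colLen 0 + 1) (rowLen_eq_zero (by omega)),
    Finset.sum_range_succ', Finset.sum_range_succ']
  simp [rowLen_addFirst, add_assoc]

/-- After the column slides down, its bottom box is the new last box of the first row, and the other
r boxes stand on it. -/
theorem mem_columnAbove_addFirst_iff (ν : YoungDiagram) (r : ℕ) (x : ℕ × ℕ) :
    x ∈ columnAbove (addFirst ν) r (ν.rowLen 0) ↔ ∃ p, columnBesidePos ν r p = x := by
  obtain ⟨i, j⟩ := x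
  simp only [columnAbove, columnBesidePos, Finset.mem_union, Finset.mem_image, Finset.mem_range,
    Sum.exists, Sum.elim_inl, Sum.elim_inr, Subtype.exists, Prod.exists, Prod.mk.injEq, mem_cells,
    mem_iff_lt_rowLen, rowLen_addFirst]
  constructor
  · rintro (⟨a, ha, rfl, rfl⟩ | ⟨a, b, h, rfl, rfl⟩)
    · exact Or.inr ⟨⟨a, by omega⟩, rfl, rfl⟩
    · split_ifs at h with h0
      · subst h0
        rcases (Nat.lt_succ_iff.1 h).lt_or_eq with h | rfl
        · exact Or.inl ⟨0, b, h, rfl, rfl⟩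
        · exact Or.inr ⟨Fin.last r, by simp, rfl⟩
      · exact Or.inl ⟨a, b, h, rfl, rfl⟩
  · rintro (⟨a, b, h, rfl, rfl⟩ | ⟨a, rfl, rfl⟩)
    · refine Or.inr ⟨a, b, ?_, rfl, rfl⟩
      split_ifs with h0
      · subst h0
        omega
      · exact h
    · rcases (Nat.lt_succ_iff.1 a.2).lt_or_eq with h | h
      · exact Or.inl ⟨a, h, rfl, rfl⟩
      · exact Or.inr ⟨0, ν.rowLen 0, by simp, by omega, rfl⟩

/-- The expansion of the skew Schur function of a Young diagram with a column on top of its last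
column. -/
theorem skewSchur_columnAbove_last (r : ℕ) (ν : YoungDiagram) (h0 : 0 < ν.rowLen 0) :
    skewSchur (columnAbove ν r (ν.rowLen 0 - 1)) =
      ∑ η ∈ (addVStrip ν r).filter (fun η => η.rowLen 0 = ν.rowLen 0), skewSchur η.cells := by
  induction r generalizing ν with
  | zero =>
    have h : (addVStrip ν 0).filter (fun η => η.rowLen 0 = ν.rowLen 0) = {ν} := by
      ext η
      rw [Finset.mem_filter, mem_addVStrip, Finset.mem_singleton]
      constructor
      · rintro ⟨⟨h, hc⟩, -⟩
        exact (YoungDiagram.ext (Finset.eq_of_subset_of_card_le h.le (by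
          have : η.cells.card = ν.cells.card + 0 := hc
          omega))).symm
      · rintro rfl
        exact ⟨⟨fun i => by omega, rfl⟩, rfl⟩
    rw [h, Finset.sum_singleton]
    congr 1
    simp [columnAbove]
  | succ r ih =>
    have h1 := ih (addFirst ν) (by rw [rowLen_addFirst]; simp)
    have hr : (addFirst ν).rowLen 0 = ν.rowLen 0 + 1 := by rw [rowLen_addFirst, if_pos rfl]
    rw [hr, Nat.add_sub_cancel] at h1
    -- The detached column is already expanded by the dual Pieri rule and the last summand by the
    -- induction hypothesis, so the attached column follows by subtraction.
    have hsplit : skewSchur (columnAbove ν (r + 1) (ν.rowLen 0)) =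
        skewSchur (columnAbove ν (r + 1) (ν.rowLen 0 - 1)) +
          skewSchur (columnAbove (addFirst ν) r (ν.rowLen 0)) := by
      funext m
      change _ = skewSchur _ m + skewSchur _ m
      rw [skewSchur_apply (columnAbovePos_injective _ _ _) (mem_columnAbove_iff _ _ _),
        skewSchur_apply (columnAbovePos_injective _ _ _) (mem_columnAbove_iff _ _ _),
        skewSchur_apply columnBesidePos_injective (mem_columnAbove_addFirst_iff ν r),
        ncard_tableaux_columnAbovePos h0, Nat.cast_add]
    -- The subtracted terms are exactly the vertical (r + 1)-strips that use row 0: one box goes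
    -- there and r boxes go into lower rows.
    have hfil : (addVStrip (addFirst ν) r).filter (fun η => η.rowLen 0 = ν.rowLen 0 + 1) =
        (addVStrip ν (r + 1)).filter fun η => ¬η.rowLen 0 = ν.rowLen 0 := by
      ext η
      simp only [Finset.mem_filter, mem_addVStrip, card_addFirst]
      constructor
      · rintro ⟨⟨h, hc⟩, h2⟩
        refine ⟨⟨fun i => ?_, by omega⟩, by omega⟩
        have := h i
        rw [rowLen_addFirst] at this
        split_ifs at this with hi
        · subst hi
          omega
        · exact this
      · rintro ⟨⟨h, hc⟩, h2⟩
        have h3 := h 0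
        refine ⟨⟨fun i => ?_, by omega⟩, by omega⟩
        have := h i
        rw [rowLen_addFirst]
        split_ifs with hi
        · subst hi
          omega
        · exact this
    rw [skewSchur_columnAbove_rowLen, h1, hfil,
      ← Finset.sum_filter_add_sum_filter_not _ fun η => η.rowLen 0 = ν.rowLen 0] at hsplit
    exact (add_right_cancel hsplit).symm

theorem schurPositive_sum {n : ℕ} {S : Finset YoungDiagram} (h : ∀ η ∈ S, η.card = n) :
    SchurPositive n (∑ η ∈ S, skewSchur η.cells) := by
  classical
  have hsub : (Finsupp.indicator S fun _ _ => (1 : ℤ)).support ⊆ S :=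
    Finsupp.support_indicator_subset _ _
  refine ⟨Finsupp.indicator S fun _ _ => 1, fun ν hν => h ν (hsub hν), fun ν => ?_, ?_⟩
  · rw [Finsupp.indicator_apply]
    split_ifs <;> simp
  · refine Eq.trans ?_ (Finsupp.sum_of_support_subset _ hsub
      (fun ν c => c • skewSchur ν.cells) fun _ _ => zero_smul _ _).symm
    refine Finset.sum_congr rfl fun η hη => ?_
    rw [Finsupp.indicator_of_mem hη, one_smul]

/-! ### The fat staircase and its rotation -/

/-- The number `s + i` repeated `b i` times for each entry `b i` of the list `b`. -/
def repeatRows (b : List ℕ) (s : ℕ) : List ℕ :=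
  (b.zipIdx s).flatMap fun p => List.replicate p.1 p.2

theorem repeatRows_cons (b : ℕ) (bs : List ℕ) (s : ℕ) :
    repeatRows (b :: bs) s = List.replicate b s ++ repeatRows bs (s + 1) := by
  simp [repeatRows]

theorem length_repeatRows (bs : List ℕ) (s : ℕ) : (repeatRows bs s).length = bs.sum := by
  induction bs generalizing s with
  | nil => rfl
  | cons b bs ih => rw [repeatRows_cons, List.length_append, List.length_replicate, ih,
      List.sum_cons]

theorem getD_repeatRows_cons (b : ℕ) (bs : List ℕ) (s i : ℕ) :
    (repeatRows (b :: bs) s).getD i 0 =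
      if i < b then s else (repeatRows bs (s + 1)).getD (i - b) 0 := by
  rw [repeatRows_cons]
  split_ifs with h
  · rw [List.getD_append _ _ _ _ (by simpa using h), List.getD_replicate _ h]
  · rw [List.getD_append_right _ _ _ _ (by simpa using h), List.length_replicate]

/-- Since no block is empty, every length between the first and the last occurs and consecutive
lengths differ by at most one. This is where the positivity of the parts of α enters. -/
theorem getD_repeatRows (bs : List ℕ) (hpos : ∀ b ∈ bs, 0 < b) (s : ℕ) :
    (∀ i, i + 1 < bs.sum →
      (repeatRows bs s).getD i 0 ≤ (repeatRows bs s).getD (i + 1) 0 ∧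
        (repeatRows bs s).getD (i + 1) 0 ≤ (repeatRows bs s).getD i 0 + 1) ∧
      (0 < bs.sum → (repeatRows bs s).getD 0 0 = s ∧
        (repeatRows bs s).getD (bs.sum - 1) 0 + 1 = s + bs.length) := by
  induction bs generalizing s with
  | nil => simp
  | cons b bs ih =>
    have hb := hpos b List.mem_cons_self
    obtain ⟨h1, h2⟩ := ih (fun c hc => hpos c (List.mem_cons_of_mem _ hc)) (s + 1)
    simp only [List.sum_cons, List.length_cons, getD_repeatRows_cons]
    refine ⟨fun i hi => ?_, fun _ => ⟨if_pos hb, ?_⟩⟩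
    · rcases lt_trichotomy (i + 1) b with h | h | h
      · rw [if_pos (by omega), if_pos h]
        omega
      · rw [if_pos (by omega), if_neg (by omega), h, Nat.sub_self, (h2 (by omega)).1]
        omega
      · rw [if_neg (by omega), if_neg (by omega), Nat.sub_add_comm (by omega)]
        exact h1 _ (by omega)
    · rcases bs.sum.eq_zero_or_pos with h | h
      · have : bs = [] := by
          rcases bs with _ | ⟨c, bs⟩
          · rfl
          · have := hpos c (by simp)
            simp only [List.sum_cons] at h
            omega
        subst this
        rw [if_pos (by simp; omega)]
        simp
      · rw [if_neg (by omega), show b + bs.sum - 1 - b = bs.sum - 1 by omega]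
        have := (h2 h).2
        omega

section staircase

variable {m : ℕ} (α : Composition m)

theorem length_fatStaircaseRows : (fatStaircaseRows α).length = m :=
  (length_repeatRows α.blocks 1).trans α.blocks_sum

theorem getD_fatStaircaseRows :
    (∀ i, i + 1 < m → (fatStaircaseRows α).getD i 0 ≤ (fatStaircaseRows α).getD (i + 1) 0 ∧
      (fatStaircaseRows α).getD (i + 1) 0 ≤ (fatStaircaseRows α).getD i 0 + 1) ∧
      (0 < m → (fatStaircaseRows α).getD 0 0 = 1 ∧
        (fatStaircaseRows α).getD (m - 1) 0 = α.length) := by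
  have h := getD_repeatRows α.blocks (fun b hb => α.blocks_pos hb) 1
  rw [α.blocks_sum] at h
  refine ⟨h.1, fun hm => ⟨(h.2 hm).1, ?_⟩⟩
  have := (h.2 hm).2
  change _ = α.blocks.length
  change (repeatRows α.blocks 1).getD (m - 1) 0 = _
  omega

/-- The fat staircase `Δ_α`, rotated by 180°. -/
def staircaseDiagram : YoungDiagram :=
  ofFun (fun i => if i < m then (fatStaircaseRows α).getD (m - 1 - i) 0 else 0)
    (antitone_nat_of_succ_le fun i => by
      by_cases hi : i + 1 < m
      · rw [if_pos hi, if_pos (by omega)]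
        have := ((getD_fatStaircaseRows α).1 (m - 1 - (i + 1)) (by omega)).1
        rwa [show m - 1 - (i + 1) + 1 = m - 1 - i by omega] at this
      · rw [if_neg hi]
        exact Nat.zero_le _) m (if_neg (lt_irrefl _))

theorem rowLen_staircaseDiagram (i : ℕ) : (staircaseDiagram α).rowLen i =
    if i < m then (fatStaircaseRows α).getD (m - 1 - i) 0 else 0 :=
  rowLen_ofFun _ _ _ _ i

theorem rowLen_staircaseDiagram_zero : (staircaseDiagram α).rowLen 0 = α.length := by
  rw [rowLen_staircaseDiagram]
  split_ifs with h
  · exact ((getD_fatStaircaseRows α).2 h).2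
  · have := α.length_le
    omega

/-- The decisive property of the staircase. It also holds at the last row, which has length 1 and is
followed by length 0. -/
theorem rowLen_staircaseDiagram_le (i : ℕ) :
    (staircaseDiagram α).rowLen i ≤ (staircaseDiagram α).rowLen (i + 1) + 1 := by
  simp only [rowLen_staircaseDiagram]
  rcases lt_trichotomy (i + 1) m with h | h | h
  · rw [if_pos (by omega), if_pos h]
    have := ((getD_fatStaircaseRows α).1 (m - 1 - (i + 1)) (by omega)).2
    rwa [show m - 1 - (i + 1) + 1 = m - 1 - i by omega] at this
  · rw [if_pos (by omega), if_neg (by omega), show m - 1 - i = 0 by omega,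
      ((getD_fatStaircaseRows α).2 (by omega)).1]
  · rw [if_neg (by omega)]
    omega

theorem lt_of_mem_staircaseDiagram {i j : ℕ} (h : (i, j) ∈ staircaseDiagram α) :
    i < m ∧ j < α.length := by
  refine ⟨?_, rowLen_staircaseDiagram_zero α ▸ rowLen_zero_of_mem h⟩
  have h' := mem_iff_lt_rowLen.1 h
  rw [rowLen_staircaseDiagram] at h'
  by_contra hi
  rw [if_neg hi] at h'
  omega

theorem mem_fatStaircase_iff {i j : ℕ} : (i, j) ∈ fatStaircase α ↔
    i < m ∧ j < α.length ∧ (m - 1 - i, α.length - 1 - j) ∈ staircaseDiagram α := by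
  simp only [fatStaircase, Finset.mem_filter, Finset.mem_product, Finset.mem_range,
    length_fatStaircaseRows, mem_iff_lt_rowLen, rowLen_staircaseDiagram, and_assoc]
  refine and_congr_right fun hi => and_congr_right fun hj => ?_
  rw [if_pos (by omega), show m - 1 - (m - 1 - i) = i by omega]
  omega

/-- The parametrization `g` of μ is left free so that a column can be listed from bottom to top, as
it appears after the rotation. -/
theorem mem_badFoundation_iff (μ : YoungDiagram) (k : ℕ) {P : Type*} (g : P → ℕ × ℕ)
    (hg : ∀ x, x ∈ μ ↔ ∃ p, g p = x) (x : ℕ × ℕ) :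
    x ∈ badFoundation μ α k ↔
      ∃ p, Sum.elim (fun y : (staircaseDiagram α).cells =>
        (m - 1 - y.1.1, α.length - 1 - y.1.2 + k)) (fun p => (m + (g p).1, (g p).2)) p = x := by
  rw [badFoundation, Finset.mem_union, Finset.mem_image, Finset.mem_image, Sum.exists]
  refine or_congr ?_ ?_
  · constructor
    · rintro ⟨⟨i, j⟩, h, rfl⟩
      rw [mem_fatStaircase_iff] at h
      refine ⟨⟨_, h.2.2⟩, ?_⟩
      simp only [Sum.elim_inl, Prod.mk.injEq]
      omega
    · rintro ⟨⟨⟨i, j⟩, h⟩, rfl⟩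
      have hlt := lt_of_mem_staircaseDiagram α h
      refine ⟨(m - 1 - i, α.length - 1 - j), ?_, rfl⟩
      rw [mem_fatStaircase_iff]
      refine ⟨by omega, by omega, ?_⟩
      rwa [show m - 1 - (m - 1 - i) = i by omega,
        show α.length - 1 - (α.length - 1 - j) = j by omega]
  · simp only [mem_cells, hg, Sum.elim_inr]
    constructor
    · rintro ⟨_, ⟨p, rfl⟩, rfl⟩
      exact ⟨p, rfl⟩
    · rintro ⟨p, rfl⟩
      exact ⟨_, ⟨p, rfl⟩, rfl⟩

theorem card_badFoundation (μ : YoungDiagram) (k : ℕ) :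
    (badFoundation μ α k).card = (staircaseDiagram α).card + μ.card := by
  let pos : (staircaseDiagram α).cells ⊕ μ.cells → ℕ × ℕ := Sum.elim
    (fun y => (m - 1 - y.1.1, α.length - 1 - y.1.2 + k)) fun p => (m + p.1.1, p.1.2)
  have h : badFoundation μ α k = Finset.univ.image pos := by
    ext x
    rw [mem_badFoundation_iff α μ k (Subtype.val : μ.cells → ℕ × ℕ) (by simp)]
    simp [pos]
  rw [h, Finset.card_image_of_injective, Finset.card_univ, Fintype.card_sum, Fintype.card_coe,
    Fintype.card_coe]
  rintro (⟨⟨i, j⟩, hx⟩ | ⟨⟨i, j⟩, hx⟩) (⟨⟨i', j'⟩, hy⟩ | ⟨⟨i', j'⟩, hy⟩) h <;>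
    simp only [pos, Sum.elim_inl, Sum.elim_inr, Prod.mk.injEq] at h
  · have := lt_of_mem_staircaseDiagram α hx
    have := lt_of_mem_staircaseDiagram α hy
    obtain rfl : i = i' := by omega
    obtain rfl : j = j' := by omega
    rfl
  · have := lt_of_mem_staircaseDiagram α hx
    omega
  · have := lt_of_mem_staircaseDiagram α hy
    omega
  · obtain rfl : i = i' := by omega
    obtain rfl : j = j' := by omega
    rfl

end staircase

/-! ### Row and column foundations -/

/-- The Young diagram `ν` with a row of `a` boxes added at the top. -/
def consRow (ν : YoungDiagram) (a : ℕ) (h : ν.rowLen 0 ≤ a) : YoungDiagram :=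
  ofFun (fun i => if i = 0 then a else ν.rowLen (i - 1))
    (antitone_nat_of_succ_le fun i => by
      rw [if_neg i.succ_ne_zero]
      split_ifs with hi
      · subst hi
        exact h
      · exact ν.rowLen_anti _ _ (by omega)) (ν.colLen 0 + 1)
    (by rw [if_neg (by omega)]; exact rowLen_eq_zero (by omega))

theorem rowLen_consRow (ν : YoungDiagram) (a : ℕ) (h : ν.rowLen 0 ≤ a) (i : ℕ) :
    (consRow ν a h).rowLen i = if i = 0 then a else ν.rowLen (i - 1) :=
  rowLen_ofFun _ _ _ _ i

theorem card_consRow (ν : YoungDiagram) (a : ℕ) (h : ν.rowLen 0 ≤ a) :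
    (consRow ν a h).card = ν.card + a := by
  rw [card_eq_sum_rowLen (consRow ν a h) (N := ν.colLen 0 + 1)
    (by rw [rowLen_consRow, if_neg (by omega)]; exact rowLen_eq_zero (by omega)),
    card_eq_sum_rowLen ν (N := ν.colLen 0) (rowLen_eq_zero le_rfl), Finset.sum_range_succ']
  simp [rowLen_consRow]

section foundation

variable {m : ℕ} (α : Composition m) {μ : YoungDiagram} {r k : ℕ}

theorem rowLen_zero_staircaseDiagram_le (k : ℕ) :
    (staircaseDiagram α).rowLen 0 ≤ α.length + k := by
  rw [rowLen_staircaseDiagram_zero]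
  omega

/-- After rotation the row occupies the last r of the first l(α) + k places above ν, so the diagram
is `consRow` minus a row of l(α) + k - r boxes. -/
theorem skewSchur_badFoundation_row (hμ : ∀ x, x ∈ μ ↔ x.1 = 0 ∧ x.2 < r)
    (hr : r ≤ α.length + k) :
    skewSchur (badFoundation μ α k) =
      ∑ η ∈ (Strip.hor (α.length + k - r)).steps
        (consRow (staircaseDiagram α) (α.length + k) (rowLen_zero_staircaseDiagram_le α k)),
        skewSchur η.cells := by
  set ν := staircaseDiagram α with hν
  set ρ := consRow ν (α.length + k) (rowLen_zero_staircaseDiagram_le α k) with hρ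
  let τ : YoungDiagram := ofFun (fun i => if i = 0 then α.length + k - r else 0)
    (antitone_nat_of_succ_le fun i => by rw [if_neg i.succ_ne_zero]; exact Nat.zero_le _) 1
    (if_neg one_ne_zero)
  have hτ : ∀ i, τ.rowLen i = if i = 0 then α.length + k - r else 0 := rowLen_ofFun _ _ _ _
  have hle : τ ≤ ρ := le_iff_rowLen.2 fun i => by
    rw [hτ, rowLen_consRow]
    split_ifs <;> omega
  let pos' : ν.cells ⊕ Fin r → ℕ × ℕ :=
    Sum.elim (fun x => (x.1.1 + 1, x.1.2)) fun i => (0, α.length + k - 1 - i)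
  refine skewSchur_rotate (P := ν.cells ⊕ Fin r) (pos' := pos') (a := m)
    (b := α.length + k - 1) ?_ ?_
    (mem_badFoundation_iff α μ k (fun i : Fin r => (0, (i : ℕ))) ?_)
    (D' := ρ.cells \ τ.cells) ?_
    (skewSchur_sdiff_eq_sum (isStep_hor_bot_iff hτ) (fun c => Strip.commutes_hor_hor c _) hle)
  · rintro (⟨⟨i, j⟩, h⟩ | i)
    · have := lt_of_mem_staircaseDiagram α h
      simp only [pos', Sum.elim_inl]
      omega
    · simp only [pos', Sum.elim_inr]
      have := i.2
      omega
  · rintro (⟨⟨i, j⟩, hx⟩ | i) (⟨⟨i', j'⟩, hy⟩ | i') h <;>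
      simp only [pos', Sum.elim_inl, Sum.elim_inr, Prod.mk.injEq] at h
    · obtain ⟨h1, rfl⟩ := h
      obtain rfl : i = i' := by omega
      rfl
    · omega
    · omega
    · have : i = i' := Fin.ext (by omega)
      rw [this]
  · rintro ⟨i, j⟩
    simp only [hμ, Fin.exists_iff, Prod.mk.injEq]
    constructor
    · rintro ⟨rfl, h⟩
      exact ⟨j, h, rfl, rfl⟩
    · rintro ⟨_, h, rfl, rfl⟩
      exact ⟨rfl, h⟩
  · rintro ⟨i, j⟩
    simp only [Finset.mem_sdiff, mem_cells, mem_iff_lt_rowLen, hτ, hρ, rowLen_consRow, Sum.exists,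
      pos', Sum.elim_inl, Sum.elim_inr, Subtype.exists, Prod.exists, Prod.mk.injEq]
    rcases i with _ | i
    · simp only [if_true]
      constructor
      · rintro ⟨h1, h2⟩
        exact Or.inr ⟨⟨α.length + k - 1 - j, by omega⟩, trivial, by simp only; omega⟩
      · rintro (⟨_, _, _, h, _⟩ | ⟨a, -, rfl⟩)
        · omega
        · have := a.2
          omega
    · simp only [i.succ_ne_zero, if_false, Nat.add_sub_cancel, not_lt, Nat.zero_le, and_true]
      constructor
      · exact fun h => Or.inl ⟨i, j, h, rfl, rfl⟩
      · rintro (⟨a, b, h, h1, rfl⟩ | ⟨_, h, _⟩)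
        · obtain rfl : a = i := by omega
          exact h
        · omega

theorem skewSchur_badFoundation_column (hμ : ∀ x, x ∈ μ ↔ x.2 = 0 ∧ x.1 < r)
    {S : Finset YoungDiagram}
    (hS : skewSchur (columnAbove (staircaseDiagram α) r (α.length + k - 1)) =
      ∑ η ∈ S, skewSchur η.cells) :
    skewSchur (badFoundation μ α k) = ∑ η ∈ S, skewSchur η.cells := by
  refine skewSchur_rotate (P := (staircaseDiagram α).cells ⊕ Fin r)
    (pos' := columnAbovePos (staircaseDiagram α) r (α.length + k - 1)) (a := m + r - 1)
    (b := α.length + k - 1) ?_ (columnAbovePos_injective _ _ _)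
    (mem_badFoundation_iff α μ k (fun i : Fin r => (r - 1 - (i : ℕ), 0)) ?_)
    (mem_columnAbove_iff _ _ _) hS
  · rintro (⟨⟨i, j⟩, h⟩ | i)
    · have := lt_of_mem_staircaseDiagram α h
      simp only [columnAbovePos, Sum.elim_inl]
      omega
    · simp only [columnAbovePos, Sum.elim_inr]
      have := i.2
      omega
  · rintro ⟨i, j⟩
    simp only [hμ, Fin.exists_iff, Prod.mk.injEq]
    constructor
    · rintro ⟨rfl, h⟩
      exact ⟨r - 1 - i, by omega, by omega, rfl⟩
    · rintro ⟨a, h, rfl, rfl⟩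
      exact ⟨rfl, by omega⟩

/-- Horizontal strips removed from `Δ_α` with a long row are vertical strips added to `Δ_α`, since
consecutive rows of `Δ_α` differ by at most one box. -/
theorem mem_addVStrip_of_isStep (hk : k ≤ 1) (hr : r ≤ α.length + k) {η : YoungDiagram}
    (h : (Strip.hor (α.length + k - r)).IsStep
      (consRow (staircaseDiagram α) (α.length + k) (rowLen_zero_staircaseDiagram_le α k)) η) :
    η ∈ addVStrip (staircaseDiagram α) r ∧
      (k = 0 → η.rowLen 0 = (staircaseDiagram α).rowLen 0) := by
  obtain ⟨h, hc⟩ := h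
  rw [card_consRow] at hc
  simp only [HStrip, rowLen_consRow, Nat.add_sub_cancel, Nat.add_eq_zero_iff, one_ne_zero,
    and_false, if_false] at h
  have h0 := rowLen_staircaseDiagram_zero α
  -- Row 0 of η has between l(α) and l(α) + k boxes: it is unchanged for k = 0 and gains at most one
  -- box for k = 1.
  have hz := h 0
  simp only [if_true] at hz
  refine ⟨mem_addVStrip.2 ⟨fun i => ⟨(h i).2, ?_⟩, by omega⟩, fun hk => by omega⟩
  rcases i with _ | i
  · omega
  · have h1 := (h (i + 1)).1
    rw [if_neg i.succ_ne_zero, Nat.add_sub_cancel] at h1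
    exact h1.trans (rowLen_staircaseDiagram_le α i)

end foundation

/-! ### Comparison of the two expansions -/

theorem theorem5p2 {m : ℕ} (α : Composition m) (lam : YoungDiagram) (k : ℕ)
    (hlam : lam.rowLens.length = 1) (hk : k ≤ 1)
    (hov : (lam.rowLen 0 : ℤ) - (k : ℤ) ≤ (α.length : ℤ)) :
    SchurPositive (badFoundation lam α k).card
      (skewSchur (badFoundation lam.transpose α k) - skewSchur (badFoundation lam α k)) := by
  classical
  rw [length_rowLens] at hlam
  set r := lam.rowLen 0 with hr
  have hrow : ∀ x, x ∈ lam ↔ x.1 = 0 ∧ x.2 < r := by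
    rintro ⟨i, j⟩
    constructor
    · intro h
      have := mem_iff_lt_colLen.1 (lam.up_left_mem le_rfl (Nat.zero_le j) h)
      obtain rfl : i = 0 := by omega
      exact ⟨rfl, mem_iff_lt_rowLen.1 h⟩
    · rintro ⟨h, h'⟩
      obtain rfl : i = 0 := h
      exact mem_iff_lt_rowLen.2 h'
  have hcol : ∀ x, x ∈ lam.transpose ↔ x.2 = 0 ∧ x.1 < r := fun x => by
    rw [mem_transpose, hrow]
    rfl
  have hr0 : 0 < r := mem_iff_lt_rowLen.1 (mem_iff_lt_colLen.2 (by omega) : (0, 0) ∈ lam)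
  have hrk : r ≤ α.length + k := by omega
  have hcard : lam.card = r := by
    rw [card_eq_sum_rowLen lam (N := 1) (rowLen_eq_zero hlam.le), Finset.sum_range_one]
  have hzero := rowLen_staircaseDiagram_zero α
  -- `V` indexes the expansion for the column: all vertical r-strips if k = 1, those avoiding row 0
  -- if k = 0. It contains the index set of the row.
  obtain ⟨V, hV, hsub, hVcard⟩ : ∃ V : Finset YoungDiagram,
      skewSchur (badFoundation lam.transpose α k) = ∑ η ∈ V, skewSchur η.cells ∧
      (Strip.hor (α.length + k - r)).steps
        (consRow (staircaseDiagram α) (α.length + k) (rowLen_zero_staircaseDiagram_le α k)) ⊆ V ∧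
      V ⊆ addVStrip (staircaseDiagram α) r := by
    rcases Nat.le_one_iff_eq_zero_or_eq_one.1 hk with rfl | rfl
    · refine ⟨_, skewSchur_badFoundation_column α hcol (k := 0) ?_, fun η hη => ?_,
        Finset.filter_subset (fun η => η.rowLen 0 = (staircaseDiagram α).rowLen 0) _⟩
      · rw [add_zero, ← hzero]
        -- For k = 0 the overlap condition gives 0 < r ≤ l(α), so the staircase has a last column to
        -- stand on.
        exact skewSchur_columnAbove_last r _ (by omega)
      · have := mem_addVStrip_of_isStep α hk hrk (Strip.mem_steps.1 hη)
        exact Finset.mem_filter.2 ⟨this.1, this.2 rfl⟩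
    · refine ⟨_, skewSchur_badFoundation_column α hcol (k := 1) ?_, fun η hη => ?_,
        Finset.Subset.refl _⟩
      · rw [Nat.add_sub_cancel, ← hzero]
        exact skewSchur_columnAbove_rowLen _ r
      · exact (mem_addVStrip_of_isStep α hk hrk (Strip.mem_steps.1 hη)).1
  -- All multiplicities are one, so the difference is the sum over the η in `V` that do not come
  -- from the row.
  rw [hV, skewSchur_badFoundation_row α hrow hrk, ← Finset.sum_sdiff hsub, add_sub_cancel_right,
    card_badFoundation, hcard]
  exact schurPositive_sum fun η hη => (mem_addVStrip.1 (hVcard (Finset.mem_sdiff.1 hη).1)).2
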